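/- **Setting.** Let $V$ be a finite set of variables, each of sort $\mathit{int}$ (domain $\mathbb Z$) or $\mathit{rat}$ (domain $\mathbb Q$). Expressions of a sort are built from variables and constants of that sort by addition and multiplication with constants; constraints compare two expressions of the same sort by $=,\neq,<,\le$, or two integer expressions by congruence or non-congruence modulo some $m\in\mathbb N$. $neg(c)$ is the constraint complementary to $c$. Properties are given by $\psi ::= c \mid \psi\wedge\psi\mid\neg\psi\mid \mathsf X_s\psi\mid\psi\,\mathsf U\,\psi$, where the variables in the constraints $c$ are of the form $v$ or $v'$ with $v\in V$ (lookahead at most $1$; $v'$ is the value of $v$ at the next instant). A trace is a non-empty finite sequence of assignments of $V$. Properties are evaluated on traces with the usual finite-trace semantics ($\mathsf X_s$ is strong next); a constraint that refers to an instant beyond the end of the trace holds. After a trace $\tau$, the property $\psi$ is in exactly one of the RV states $\textsc{cs},\textsc{ps}$ (if $\tau\models\psi$, and $\tau\tau'\not\models\psi$ for some trace $\tau'$, respectively $\tau\tau'\models\psi$ for every trace $\tau'$), $\textsc{cv},\textsc{pv}$ (if $\tau\not\models\psi$, and $\tau\tau'\models\psi$ for some trace $\tau'$, respectively $\tau\tau'\not\models\psi$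 for every trace $\tau'$). Monitoring is *solvable* for $\psi$ if there is an algorithm that computes the RV state of $\psi$ after any given trace. **The automaton.** Bring $\psi$ into negation normal form over $c,\neg c,\wedge,\vee,\mathsf X_s,\mathsf X_w,\mathsf G,\mathsf U$ (with $\neg(a\,\mathsf U\,b)$ written as $\mathsf G\neg b\vee(\neg b\,\mathsf U\,(\neg a\wedge\neg b))$), and translate lookahead to lookback over two copies $V_{pre},V_{cur}$ of $V$: in a constraint without lookahead, $v$ becomes $v_{cur}$; a constraint $c$ with lookahead is replaced by $\mathsf X_w\bar c$, and $\neg c$ by $\mathsf X_s\neg\bar c$, where $\bar c$ is $c$ with $v,v'$ replaced by $v_{pre},v_{cur}$. Let $\psi_{back}$ be the result, $C$ its set of constraints, $C^{\pm}=C\cup\{neg(c)\mid c\in C\}$. For sets $R_1,R_2$ of pairs (property, symbol), let $R_1\otimes R_2$ consist of all $(\phi_1\wedge\phi_2,\varsigma_1\cup\varsigma_2)$ with $(\phi_i,\varsigma_i)\in R_i$ and $\varsigma_1\cup\varsigma_2$ satisfiable and not containing both $\lambda$ and $\neg\lambda$, with $\phi_1\wedge\phi_2$ simplified to irredundant disjunctive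 normal form; similarly $\oplus$ with $\vee$. Define $\delta(\top)=\{(\top,\emptyset)\}$, $\delta(\bot)=\{(\bot,\emptyset)\}$, $\delta(c)=\{(\top,\{c\}),(\bot,\{neg(c)\})\}$, $\delta(\neg c)=\{(\bot,\{c\}),(\top,\{neg(c)\})\}$, $\delta(a\wedge b)=\delta(a)\otimes\delta(b)$, $\delta(a\vee b)=\delta(a)\oplus\delta(b)$, $\delta(\mathsf X_s a)=\{(a,\{\neg\lambda\}),(\bot,\{\lambda\})\}$, $\delta(\mathsf X_w a)=\{(a,\{\neg\lambda\}),(\top,\{\lambda\})\}$, $\delta(\mathsf G a)=\delta(a)\otimes\delta(\mathsf X_w\mathsf G a)$, $\delta(a\,\mathsf U\,b)=\delta(b)\oplus(\delta(a)\otimes\delta(\mathsf X_s(a\,\mathsf U\,b)))$. The NFA has initial state $q_0=\psi_{back}$, final states $\top,q_+$, a further state $q_-$, and all properties reachable from $q_0$ or $\top$ through $\delta$ as states; each $(q',\varsigma)\in\delta(q)$ gives the transition $q\to q'$ labelled $\varsigma\setminus\{\neg\lambda\}$ if $\lambda\notin\varsigma$, and, if $\lambda\in\varsigma$, a transition labelled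 $\varsigma\setminus\{\lambda\}$ to $q_+$ if $q'=\top$ and to $q_-$ if $q'=\bot$. Let $\Theta$ (resp. $\Theta_{cur}$) be the set of maximal satisfiable subsets of $C^{\pm}$ (resp. of the same set formed from those $c\in C$ that do not mention $V_{pre}$). The DFA $D_\psi$ is obtained by the subset construction: its states are the sets $P$ of NFA states, its initial state is $\{q_0\}$, and $P$ goes on $\varsigma$ to $\{q'\mid q\in P,\ q\to q' \text{ with a label } \varsigma'\subseteq\varsigma\}$, where $\varsigma\in\Theta_{cur}$ if $P=\{q_0\}$ and $\varsigma\in\Theta$ otherwise. **Finite summary.** Let $V_0=\{v_0\mid v\in V\}$ be a further copy of $V$. For a first-order formula $\varphi$ of linear arithmetic with free variables in $V_0\cup V$ and a set $\varsigma$ of constraints over $V_{pre}\cup V_{cur}$, let $update(\varphi,\varsigma)=\exists\vec U.\,\varphi(\vec U)\wedge\bigwedge\varsigma(\vec U,\vec V)$, where $\varphi(\vec U)$ is $\varphi$ with $\vec V$ replaced by $\vec U$, and $\vec V_{pre},\vec V_{cur}$ are replaced by $\vec U,\vec V$ in $\varsigma$. The history constraint of a word is given by $h(\epsilon)=\bigwedge_{v\in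 V}v=v_0$ and $h(w\varsigma)=update(h(w),\varsigma)$. A history set is an inclusion-minimal set $\Phi$ of pairs $(P,\varphi)$ of a state of $D_\psi$ and such a formula with the following property: for every state $P$ reachable from the initial state of $D_\psi$ and every word $w$ that leads from $P$ to $P'$, there is some $(P',\varphi)\in\Phi$ with $h(w)\equiv\varphi$. A summary is a pair $(\Phi,\sim)$ of a history set and an equivalence relation on formulas with: (1) $\sim$ contains logical equivalence $\equiv$, and is decidable on the formulas occurring in $\Phi$; (2) for all $(q,\varphi),(q,\chi)\in\Phi$ with $\varphi\sim\chi$: (a) if $\alpha\models\varphi$ then some $\alpha'\models\chi$ agrees with $\alpha$ on $V_0$, and (b) $update(\varphi,\varsigma)\sim update(\chi,\varsigma)$ for every transition of $D_\psi$ from $q$ on $\varsigma$. The property $\psi$ has finite summary if there is a summary $(\Phi,\sim)$ such that $\sim$ has finitely many equivalence classes on the formulas occurring in $\Phi$. **Corollary.** Let $\psi$ be a property with lookahead at most $1$. If $\psi$ has finite summary, then monitoring is solvable for $\psi$. -/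

import Mathlib

namespace ALTLf

noncomputable section

open scoped Classical

/-! ### Sorts, expressions, constraints -/

/-- The two sorts. -/
inductive Srt
  | int
  | rat
deriving DecidableEq

/-- The domain of a sort. -/
abbrev Dom : Srt → Type
  | .int => ℤ
  | .rat => ℚ

instance instCommRingDom : (s : Srt) → CommRing (Dom s)
  | .int => inferInstanceAs (CommRing ℤ)
  | .rat => inferInstanceAs (CommRing ℚ)

instance instLinearOrderDom : (s : Srt) → LinearOrder (Dom s)
  | .int => inferInstanceAs (LinearOrder ℤ)
  | .rat => inferInstanceAs (LinearOrder ℚ)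

/-- An assignment for a sorted family `X` of variables (`X s` are the variables of sort `s`). -/
abbrev Assign (X : Srt → Type) : Type := (s : Srt) → X s → Dom s

/-- Expressions of sort `s`. -/
inductive Expr (X : Srt → Type) (s : Srt) : Type
  | var (x : X s)
  | const (k : Dom s)
  | add (a b : Expr X s)
  | smul (k : Dom s) (a : Expr X s)

namespace Expr

variable {X Y : Srt → Type} {s : Srt}

def eval (α : Assign X) : Expr X s → Dom s
  | var x => α s x
  | const k => k
  | add a b => a.eval α + b.eval α
  | smul k a => k * a.eval α

/-- Replacement of variables. -/
def map (f : (s : Srt) → X s → Y s) : Expr X s → Expr Y s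
  | var x => var (f s x)
  | const k => const k
  | add a b => add (a.map f) (b.map f)
  | smul k a => smul k (a.map f)

/-- Some variable of the expression satisfies `p`. -/
def Mentions (p : (s : Srt) → X s → Prop) : Expr X s → Prop
  | var x => p s x
  | const _ => False
  | add a b => a.Mentions p ∨ b.Mentions p
  | smul _ a => a.Mentions p

end Expr

/-- Constraints; `cong m a b` is congruence of `a` and `b` modulo `m`. -/
inductive Cstr (X : Srt → Type) : Type
  | eq (s : Srt) (a b : Expr X s)
  | ne (s : Srt) (a b : Expr X s)
  | lt (s : Srt) (a b : Expr X s)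
  | le (s : Srt) (a b : Expr X s)
  | cong (m : ℕ) (a b : Expr X .int)
  | ncong (m : ℕ) (a b : Expr X .int)

namespace Cstr

variable {X Y : Srt → Type}

def Holds (α : Assign X) : Cstr X → Prop
  | eq _ a b => a.eval α = b.eval α
  | ne _ a b => a.eval α ≠ b.eval α
  | lt _ a b => a.eval α < b.eval α
  | le _ a b => a.eval α ≤ b.eval α
  | cong m a b => Int.ModEq m (a.eval α) (b.eval α)
  | ncong m a b => ¬ Int.ModEq m (a.eval α) (b.eval α)

def map (f : (s : Srt) → X s → Y s) : Cstr X → Cstr Y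
  | eq s a b => eq s (a.map f) (b.map f)
  | ne s a b => ne s (a.map f) (b.map f)
  | lt s a b => lt s (a.map f) (b.map f)
  | le s a b => le s (a.map f) (b.map f)
  | cong m a b => cong m (a.map f) (b.map f)
  | ncong m a b => ncong m (a.map f) (b.map f)

def Mentions (p : (s : Srt) → X s → Prop) : Cstr X → Prop
  | eq _ a b => a.Mentions p ∨ b.Mentions p
  | ne _ a b => a.Mentions p ∨ b.Mentions p
  | lt _ a b => a.Mentions p ∨ b.Mentions p
  | le _ a b => a.Mentions p ∨ b.Mentions p
  | cong _ a b => a.Mentions p ∨ b.Mentions p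
  | ncong _ a b => a.Mentions p ∨ b.Mentions p

/-- The complementary constraint, obtained by flipping the comparison operator. -/
def neg : Cstr X → Cstr X
  | eq s a b => ne s a b
  | ne s a b => eq s a b
  | lt s a b => le s b a
  | le s a b => lt s b a
  | cong m a b => ncong m b a
  | ncong m a b => cong m b a

end Cstr

/-! ### Properties, traces, monitoring states

The finite set `V` of state variables has `n s` variables of each sort `s`. -/

/-- The state variables of sort `s`. -/
abbrev Var (n : Srt → ℕ) (s : Srt) : Type := Fin (n s)

/-- Variables with lookahead: `(v, j)` is `v` decorated with `j` primes. -/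
abbrev LVar (n : Srt → ℕ) (s : Srt) : Type := Var n s × ℕ

/-- The properties of the logic. -/
inductive Property (n : Srt → ℕ) : Type
  | con (c : Cstr (LVar n))
  | and (a b : Property n)
  | not (a : Property n)
  | next (a : Property n)
  | til (a b : Property n)

variable {n : Srt → ℕ}

/-- The constraint mentions a variable with lookahead at least `j`. -/
def HasLookaheadGE (j : ℕ) (c : Cstr (LVar n)) : Prop := c.Mentions (fun _ x => j ≤ x.2)

/-- All variables of the property have lookahead at most `m`. -/
def Property.LookaheadLE (m : ℕ) : Property n → Prop
  | .con c => ¬ HasLookaheadGE (m + 1) c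
  | .and a b => a.LookaheadLE m ∧ b.LookaheadLE m
  | .not a => a.LookaheadLE m
  | .next a => a.LookaheadLE m
  | .til a b => a.LookaheadLE m ∧ b.LookaheadLE m

/-- A finite sequence of assignments. It is a trace if it is non-empty. -/
abbrev Seq (n : Srt → ℕ) : Type := List (Assign (Var n))

/-- The assignment to variables with lookahead at instant `i`
(the value `0` beyond the end of the trace is never used by well-defined constraints). -/
def lookaheadAssign (τ : Seq n) (i : ℕ) : Assign (LVar n) :=
  fun s x => τ.getD (i + x.2) (fun _ _ => 0) s x.1

/-- All variables of `c` refer to instants of the trace, when `c` is evaluated at `i`. -/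
def WellDefined (τ : Seq n) (i : ℕ) (c : Cstr (LVar n)) : Prop :=
  i < τ.length ∧ ¬ c.Mentions (fun _ x => ¬ i + x.2 < τ.length)

/-- The unfolding of the until operator on a trace of length `N`. -/
inductive UntilAt (N : ℕ) (A B : ℕ → Prop) : ℕ → Prop
  | now {i : ℕ} : i < N → B i → UntilAt N A B i
  | later {i : ℕ} : i + 1 < N → A i → UntilAt N A B (i + 1) → UntilAt N A B i

/-- Satisfaction at an instant. -/
def SatAt (τ : Seq n) : Property n → ℕ → Prop
  | .con c, i => i < τ.length ∧ (¬ WellDefined τ i c ∨ c.Holds (lookaheadAssign τ i))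
  | .and a b, i => SatAt τ a i ∧ SatAt τ b i
  | .not a, i => ¬ SatAt τ a i
  | .next a, i => i + 1 < τ.length ∧ SatAt τ a (i + 1)
  | .til a b, i => UntilAt τ.length (SatAt τ a) (SatAt τ b) i

/-- `τ ⊨ ψ`. -/
def Sat (τ : Seq n) (ψ : Property n) : Prop := SatAt τ ψ 0

/-- The monitoring states: permanent satisfaction, current satisfaction, current violation,
permanent violation. -/
inductive RV
  | ps
  | cs
  | cv
  | pv

/-- The property `ψ` is in the given monitoring state after the trace `τ`. -/
def InState (ψ : Property n) (τ : Seq n) : RV → Prop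
  | .cs => Sat τ ψ ∧ ∃ τ' : Seq n, τ' ≠ [] ∧ ¬ Sat (τ ++ τ') ψ
  | .ps => Sat τ ψ ∧ ∀ τ' : Seq n, τ' ≠ [] → Sat (τ ++ τ') ψ
  | .cv => ¬ Sat τ ψ ∧ ∃ τ' : Seq n, τ' ≠ [] ∧ Sat (τ ++ τ') ψ
  | .pv => ¬ Sat τ ψ ∧ ∀ τ' : Seq n, τ' ≠ [] → ¬ Sat (τ ++ τ') ψ

/-- Numbering of the monitoring states. -/
def rvEquiv : RV ≃ Fin 4 where
  toFun
    | .ps => 0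
    | .cs => 1
    | .cv => 2
    | .pv => 3
  invFun
    | 0 => .ps
    | 1 => .cs
    | 2 => .cv
    | 3 => .pv
  left_inv x := by cases x <;> rfl
  right_inv x := by fin_cases x <;> rfl

instance instPrimcodableRV : Primcodable RV := Primcodable.ofEquiv (Fin 4) rvEquiv

/-- Finite data that represent a sequence of assignments: integers, and the rational number
`p / (q + 1)` as the pair `(p, q)`. -/
abbrev SeqCode (n : Srt → ℕ) : Type :=
  List ((Fin (n .int) → ℤ) × (Fin (n .rat) → ℤ × ℕ))

/-- The represented sequence of assignments. -/
def decodeSeq (t : SeqCode n) : Seq n :=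
  t.map fun a s => match s with
    | .int => fun v => a.1 v
    | .rat => fun v => ((a.2 v).1 : ℚ) / (((a.2 v).2 : ℚ) + 1)

/-- Monitoring is solvable for `ψ`: an algorithm computes the monitoring state of `ψ` after
any given trace. -/
def MonitoringSolvable (ψ : Property n) : Prop :=
  ∃ f : SeqCode n → RV, Computable f ∧ ∀ t : SeqCode n, t ≠ [] → InState ψ (decodeSeq t) (f t)

/-! ### Lookback properties in negation normal form -/

/-- Tags for the previous and the current instant. -/
inductive Time
  | pre
  | cur

/-- The variables `v_pre` and `v_cur`. -/
abbrev BVar (n : Srt → ℕ) (s : Srt) : Type := Time × Var n s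

/-- Lookback properties in negation normal form, with the additional `⊤` and `⊥`. -/
inductive BProp (n : Srt → ℕ) : Type
  | tt
  | ff
  | con (c : Cstr (BVar n))
  | ncon (c : Cstr (BVar n))
  | and (a b : BProp n)
  | or (a b : BProp n)
  | snext (a : BProp n)
  | wnext (a : BProp n)
  | glob (a : BProp n)
  | til (a b : BProp n)

/-- Without lookahead, `v` becomes `v_cur`. -/
def toCur (c : Cstr (LVar n)) : Cstr (BVar n) := c.map fun _ x => (.cur, x.1)

/-- With lookahead `1`, `v` becomes `v_pre` and `v'` becomes `v_cur`. -/
def toPreCur (c : Cstr (LVar n)) : Cstr (BVar n) :=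
  c.map fun _ x => (if x.2 = 0 then .pre else .cur, x.1)

/-- Negation normal form and replacement of lookahead by lookback. `back true ψ` translates `ψ`,
and `back false ψ` translates `¬ ψ`. -/
def back : Bool → Property n → BProp n
  | true, .con c => if HasLookaheadGE 1 c then .wnext (.con (toPreCur c)) else .con (toCur c)
  | false, .con c => if HasLookaheadGE 1 c then .snext (.ncon (toPreCur c)) else .ncon (toCur c)
  | true, .and a b => .and (back true a) (back true b)
  | false, .and a b => .or (back false a) (back false b)
  | true, .not a => back false a
  | false, .not a => back true a
  | true, .next a => .snext (back true a)
  | false, .next a => .wnext (back false a)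
  | true, .til a b => .til (back true a) (back true b)
  | false, .til a b =>
    .or (.glob (back false b)) (.til (back false b) (.and (back false a) (back false b)))

/-- The constraints in a lookback property. -/
def BProp.cstrs : BProp n → Finset (Cstr (BVar n))
  | .tt => ∅
  | .ff => ∅
  | .con c => {c}
  | .ncon c => {c}
  | .and a b => a.cstrs ∪ b.cstrs
  | .or a b => a.cstrs ∪ b.cstrs
  | .snext a => a.cstrs
  | .wnext a => a.cstrs
  | .glob a => a.cstrs
  | .til a b => a.cstrs ∪ b.cstrs

/-! ### Propositional simplification

Lookback properties are simplified to irredundant disjunctive normal form, where the properties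
that are neither `⊤`, `⊥`, nor conjunctions or disjunctions are the atoms. -/

/-- The disjunctive normal form, as a set of sets of atoms. -/
def BProp.dnf : BProp n → Finset (Finset (BProp n))
  | .tt => {∅}
  | .ff => ∅
  | .and a b => Finset.image₂ (fun K L => K ∪ L) a.dnf b.dnf
  | .or a b => a.dnf ∪ b.dnf
  | a => {{a}}

def conjList : List (BProp n) → BProp n
  | [] => .tt
  | [a] => a
  | a :: b :: l => .and a (conjList (b :: l))

def disjList : List (BProp n) → BProp n
  | [] => .ff
  | [a] => a
  | a :: b :: l => .or a (disjList (b :: l))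

/-- The disjunction of the inclusion-minimal conjunctions of the disjunctive normal form. -/
def BProp.simplify (a : BProp n) : BProp n :=
  disjList ((a.dnf.filter fun K => ∀ L ∈ a.dnf, L ⊆ K → L = K).toList.map
    fun K => conjList K.toList)

/-! ### The automata -/

/-- A symbol: a finite set of constraints over `V_pre` and `V_cur`. -/
abbrev Sym (n : Srt → ℕ) : Type := Finset (Cstr (BVar n))

/-- Some assignment to `V_pre` and `V_cur` satisfies all constraints of the symbol. -/
def SymSat (ς : Sym n) : Prop := ∃ α : Assign (BVar n), ∀ c ∈ ς, c.Holds α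

/-- A symbol that may also contain the markers `λ` (`last = true`) and `¬λ` (`notLast = true`). -/
structure LSym (n : Srt → ℕ) where
  cs : Sym n
  last : Bool
  notLast : Bool

def LSym.union (x y : LSym n) : LSym n :=
  ⟨x.cs ∪ y.cs, x.last || y.last, x.notLast || y.notLast⟩

def LSym.IsSat (x : LSym n) : Prop := ¬ (x.last = true ∧ x.notLast = true) ∧ SymSat x.cs

def oAnd (R₁ R₂ : Set (BProp n × LSym n)) : Set (BProp n × LSym n) :=
  {p | ∃ x ∈ R₁, ∃ y ∈ R₂, (x.2.union y.2).IsSat ∧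
    p = ((BProp.and x.1 y.1).simplify, x.2.union y.2)}

def oOr (R₁ R₂ : Set (BProp n × LSym n)) : Set (BProp n × LSym n) :=
  {p | ∃ x ∈ R₁, ∃ y ∈ R₂, (x.2.union y.2).IsSat ∧
    p = ((BProp.or x.1 y.1).simplify, x.2.union y.2)}

/-- The value of `δ` at a strong next. -/
def deltaSnext (a : BProp n) : Set (BProp n × LSym n) :=
  {(a, ⟨∅, false, true⟩), (.ff, ⟨∅, true, false⟩)}

/-- The value of `δ` at a weak next. -/
def deltaWnext (a : BProp n) : Set (BProp n × LSym n) :=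
  {(a, ⟨∅, false, true⟩), (.tt, ⟨∅, true, false⟩)}

def delta : BProp n → Set (BProp n × LSym n)
  | .tt => {(.tt, ⟨∅, false, false⟩)}
  | .ff => {(.ff, ⟨∅, false, false⟩)}
  | .con c => {(.tt, ⟨{c}, false, false⟩), (.ff, ⟨{c.neg}, false, false⟩)}
  | .ncon c => {(.ff, ⟨{c}, false, false⟩), (.tt, ⟨{c.neg}, false, false⟩)}
  | .and a b => oAnd (delta a) (delta b)
  | .or a b => oOr (delta a) (delta b)
  | .snext a => deltaSnext a
  | .wnext a => deltaWnext a
  | .glob a => oAnd (delta a) (deltaWnext (.glob a))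
  | .til a b => oOr (delta b) (oAnd (delta a) (deltaSnext (.til a b)))

/-- States of the nondeterministic automaton: quoted properties and the two extra states. -/
inductive NState (n : Srt → ℕ) : Type
  | quot (a : BProp n)
  | qplus
  | qminus

/-- The states of the nondeterministic automaton with initial state `q₀`. -/
inductive NReach (q₀ : BProp n) : NState n → Prop
  | init : NReach q₀ (.quot q₀)
  | top : NReach q₀ (.quot .tt)
  | qplus : NReach q₀ .qplus
  | qminus : NReach q₀ .qminus
  | step {a b : BProp n} {ς : LSym n} :
      NReach q₀ (.quot a) → (b, ς) ∈ delta a → NReach q₀ (.quot b)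

/-- The transitions of the nondeterministic automaton with initial state `q₀`. -/
inductive NTrans (q₀ : BProp n) : NState n → Sym n → NState n → Prop
  | inner {a b : BProp n} {ς : LSym n} : NReach q₀ (.quot a) → (b, ς) ∈ delta a →
      ς.last = false → NTrans q₀ (.quot a) ς.cs (.quot b)
  | acc {a : BProp n} {ς : LSym n} : NReach q₀ (.quot a) → (.tt, ς) ∈ delta a →
      ς.last = true → NTrans q₀ (.quot a) ς.cs .qplus
  | rej {a : BProp n} {ς : LSym n} : NReach q₀ (.quot a) → (.ff, ς) ∈ delta a →
      ς.last = true → NTrans q₀ (.quot a) ς.cs .qminus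

/-- The states of the deterministic automaton are sets of states of the nondeterministic one. -/
abbrev DState (n : Srt → ℕ) : Type := Set (NState n)

/-- A deterministic automaton that reads symbols; its (partial) transition function is given
as a relation. -/
structure Automaton (n : Srt → ℕ) where
  states : Set (DState n)
  start : DState n
  trans : DState n → Sym n → DState n → Prop
  final : Set (DState n)

/-- `P` goes to `P'` on the word `w`. -/
inductive Automaton.Path (D : Automaton n) : DState n → List (Sym n) → DState n → Prop
  | nil (P : DState n) : Path D P [] P
  | cons {P P' P'' : DState n} {ς : Sym n} {w : List (Sym n)} :
      D.trans P ς P' → Path D P' w P'' → Path D P (ς :: w) P''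

/-- The maximal satisfiable subsets of `C ∪ {neg c | c ∈ C}`. -/
def maxSat (C : Sym n) : Set (Sym n) :=
  {ς | Maximal (fun x : Sym n => x ⊆ C ∪ C.image Cstr.neg ∧ SymSat x) ς}

/-- The constraints that do not mention `V_pre`. -/
def curPart (C : Sym n) : Sym n := C.filter fun c => ¬ c.Mentions fun _ x => x.1 = .pre

/-- The automaton of a property: the subset construction. In the initial state, it reads
maximal satisfiable sets of constraints that do not mention `V_pre`, in all other states it reads
maximal satisfiable sets of arbitrary constraints of the property. -/
def dfa (ψ : Property n) : Automaton n where
  states := {P | ∀ q ∈ P, NReach (back true ψ) q}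
  start := {.quot (back true ψ)}
  trans P ς P' :=
    (∀ q ∈ P, NReach (back true ψ) q) ∧
    ((P = {.quot (back true ψ)} ∧ ς ∈ maxSat (curPart (back true ψ).cstrs)) ∨
      (P ≠ {.quot (back true ψ)} ∧ ς ∈ maxSat (back true ψ).cstrs)) ∧
    P' = {q' | ∃ q ∈ P, ∃ x : Sym n, NTrans (back true ψ) q x q' ∧ x ⊆ ς}
  final := {P | (∀ q ∈ P, NReach (back true ψ) q) ∧ (NState.quot .tt ∈ P ∨ NState.qplus ∈ P)}

/-! ### Formulas of linear arithmetic and history constraints -/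

/-- Names of variables in formulas: copies of the state variables. The copy `(0, v)` is the
placeholder `v₀` for the initial value of `v`, the copy `(1, v)` is `v` itself. The other copies
are used for auxiliary variables. -/
abbrev FVar (n : Srt → ℕ) (s : Srt) : Type := ℕ × Var n s

/-- First-order formulas whose atoms are constraints. -/
inductive Formula (n : Srt → ℕ) : Type
  | tru
  | atom (c : Cstr (FVar n))
  | not (a : Formula n)
  | and (a b : Formula n)
  | or (a b : Formula n)
  | ex (s : Srt) (x : FVar n s) (a : Formula n)

namespace Formula

/-- Satisfaction of a formula by an assignment. -/
def Holds : Formula n → Assign (FVar n) → Prop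
  | tru, _ => True
  | atom c, ν => c.Holds ν
  | not a, ν => ¬ a.Holds ν
  | and a b, ν => a.Holds ν ∧ b.Holds ν
  | or a b, ν => a.Holds ν ∨ b.Holds ν
  | ex s x a, ν => ∃ d : Dom s, a.Holds (Function.update ν s (Function.update (ν s) x d))

/-- Some free variable of the formula satisfies `p`. -/
def MentionsFree : Formula n → ((s : Srt) → FVar n s → Prop) → Prop
  | tru, _ => False
  | atom c, p => c.Mentions p
  | not a, p => a.MentionsFree p
  | and a b, p => a.MentionsFree p ∨ b.MentionsFree p
  | or a b, p => a.MentionsFree p ∨ b.MentionsFree p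
  | ex s x a, p => a.MentionsFree fun s' y => p s' y ∧ (⟨s', y⟩ : (s : Srt) × FVar n s) ≠ ⟨s, x⟩

/-- The free variables of the formula are among `V₀ ∪ V`. -/
def IsOver (a : Formula n) : Prop := ¬ a.MentionsFree fun _ x => 2 ≤ x.1

/-- Replacement of all variables, free and bound. -/
def rename (f : ℕ → ℕ) : Formula n → Formula n
  | tru => tru
  | atom c => atom (c.map fun _ x => (f x.1, x.2))
  | not a => not (a.rename f)
  | and a b => and (a.rename f) (b.rename f)
  | or a b => or (a.rename f) (b.rename f)
  | ex s x a => ex s (f x.1, x.2) (a.rename f)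

/-- Logical equivalence. -/
def Equiv (a b : Formula n) : Prop := ∀ ν, a.Holds ν ↔ b.Holds ν

def conj (l : List (Formula n)) : Formula n := l.foldr and tru

/-- Existential quantification over all variables of the copy `k`. -/
def exBlock (k : ℕ) (a : Formula n) : Formula n :=
  (List.finRange (n .int)).foldr (fun v b => ex .int (k, v) b)
    ((List.finRange (n .rat)).foldr (fun v b => ex .rat (k, v) b) a)

/-- The formula that equates every state variable `v` with `v₀`. -/
def init : Formula n :=
  and
    (conj ((List.finRange (n .int)).map fun v => atom (.eq .int (.var (1, v)) (.var (0, v)))))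
    (conj ((List.finRange (n .rat)).map fun v => atom (.eq .rat (.var (1, v)) (.var (0, v)))))

/-- The formula `∃ U, φ(U) ∧ ⋀ C(U, V)`, where `U` is the copy `2` of `V`. The formula `φ(U)` is
obtained from `φ` by swapping the copies `1` and `2`; as bound variables are swapped as well, no
variable is captured. -/
def update (φ : Formula n) (ς : Sym n) : Formula n :=
  exBlock 2 (and (φ.rename (_root_.Equiv.swap 1 2))
    (conj (ς.toList.map fun c => atom (c.map fun _ x =>
      (match x.1 with
        | .pre => 2
        | .cur => 1, x.2)))))

/-- The history constraint of a word. -/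
def history (w : List (Sym n)) : Formula n := w.foldl update init

end Formula

/-! ### Summaries -/

/-- Every word that connects two reachable states has its history constraint in `Φ`,
up to equivalence. -/
def CoversHistories (D : Automaton n) (Φ : Set (DState n × Formula n)) : Prop :=
  (∀ p ∈ Φ, p.1 ∈ D.states ∧ p.2.IsOver) ∧
  ∀ (w₀ : List (Sym n)) (P : DState n) (w : List (Sym n)) (P' : DState n),
    D.Path D.start w₀ P → D.Path P w P' →
      ∃ φ : Formula n, (P', φ) ∈ Φ ∧ (Formula.history w).Equiv φ

/-- History sets. -/
def IsHistorySet (D : Automaton n) (Φ : Set (DState n × Formula n)) : Prop :=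
  Minimal (CoversHistories D) Φ

/-- Injective coding of constants, expressions, constraints and formulas by numbers. -/
def Dom.code : (s : Srt) → Dom s → ℕ
  | .int, k => Encodable.encode (k : ℤ)
  | .rat, k => Nat.pair (Encodable.encode (k : ℚ).num) (k : ℚ).den

def Srt.code : Srt → ℕ
  | .int => 0
  | .rat => 1

def Expr.code {s : Srt} : Expr (FVar n) s → ℕ
  | .var x => Nat.pair 0 (Nat.pair x.1 x.2)
  | .const k => Nat.pair 1 (Dom.code s k)
  | .add a b => Nat.pair 2 (Nat.pair a.code b.code)
  | .smul k a => Nat.pair 3 (Nat.pair (Dom.code s k) a.code)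

def Cstr.code : Cstr (FVar n) → ℕ
  | .eq s a b => Nat.pair 0 (Nat.pair s.code (Nat.pair a.code b.code))
  | .ne s a b => Nat.pair 1 (Nat.pair s.code (Nat.pair a.code b.code))
  | .lt s a b => Nat.pair 2 (Nat.pair s.code (Nat.pair a.code b.code))
  | .le s a b => Nat.pair 3 (Nat.pair s.code (Nat.pair a.code b.code))
  | .cong m a b => Nat.pair 4 (Nat.pair m (Nat.pair a.code b.code))
  | .ncong m a b => Nat.pair 5 (Nat.pair m (Nat.pair a.code b.code))

def Formula.code : Formula n → ℕ
  | .tru => Nat.pair 0 0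
  | .atom c => Nat.pair 1 c.code
  | .not a => Nat.pair 2 a.code
  | .and a b => Nat.pair 3 (Nat.pair a.code b.code)
  | .or a b => Nat.pair 4 (Nat.pair a.code b.code)
  | .ex s x a => Nat.pair 5 (Nat.pair s.code (Nat.pair (Nat.pair x.1 x.2) a.code))

/-- An algorithm decides the relation on the formulas of a given set. -/
def DecidableOn (F : Set (Formula n)) (sim : Formula n → Formula n → Prop) : Prop :=
  ∃ f : ℕ → ℕ →. Bool, Partrec₂ f ∧ ∀ φ ∈ F, ∀ χ ∈ F,
    (sim φ χ → true ∈ f φ.code χ.code) ∧ (¬ sim φ χ → false ∈ f φ.code χ.code)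

/-- Summaries. The equivalence relation on the formulas of `Φ` is given together with its values
on all formulas over `V₀ ∪ V`, on which it contains logical equivalence. -/
structure IsSummary (D : Automaton n) (Φ : Set (DState n × Formula n))
    (sim : Formula n → Formula n → Prop) : Prop where
  historySet : IsHistorySet D Φ
  equivalence : Equivalence sim
  contains_equiv : ∀ φ χ : Formula n, φ.IsOver → χ.IsOver → φ.Equiv χ → sim φ χ
  decidable : DecidableOn (Prod.snd '' Φ) sim
  initial : ∀ (P : DState n) (φ χ : Formula n), (P, φ) ∈ Φ → (P, χ) ∈ Φ → sim φ χ →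
    ∀ α : Assign (FVar n), φ.Holds α →
      ∃ α' : Assign (FVar n), χ.Holds α' ∧ ∀ (s : Srt) (v : Var n s), α s (0, v) = α' s (0, v)
  step : ∀ (P : DState n) (φ χ : Formula n), (P, φ) ∈ Φ → (P, χ) ∈ Φ → sim φ χ →
    ∀ (ς : Sym n) (P' : DState n), D.trans P ς P' → sim (φ.update ς) (χ.update ς)

/-- `ψ` has a finite summary: the relation has finitely many equivalence classes on the
formulas of the history set. -/
def HasFiniteSummary (ψ : Property n) : Prop :=
  ∃ (Φ : Set (DState n × Formula n)) (sim : Formula n → Formula n → Prop),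
    IsSummary (dfa ψ) Φ sim ∧
    {K : Set (Formula n) | ∃ φ ∈ Prod.snd '' Φ, K = {χ ∈ Prod.snd '' Φ | sim φ χ}}.Finite

end

end ALTLf

/-!
The algorithm for a fixed property `ψ` reads the trace with the automaton `dfa ψ` and keeps only the
reached state `P` and the last assignment `α`. It has to decide whether `P` is final and whether
some nonempty extension of the trace leads to a final or to a non-final state. Three facts make this
possible.

* The automaton has finitely many states and accepts exactly the traces that satisfy `ψ`
  (`finite_states`, `run_mem_final_iff`). Before the last instant a transition preserves truth values
  (`bsat_iff_of_mem_delta`); at the last instant the marker `¬λ` may be guessed wrongly, which does no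
  harm because strong next is never applied to a property that contains `⊤` (`bsat_of_atEnd`).

* Extensions of bounded length suffice (`exists_bound`). The history constraint of a word relates the
  first and the last assignment of the sequences along which the word can be read
  (`Formula.holds_history`). If the history constraints of two words between the same states are
  equivalent for the summary, then one word can be read from `α` if and only if the other can. As
  there are finitely many states and classes, one word for each source, target and class is enough.

* For a fixed length, the set of assignments from which a given set of states can be reached is
  definable without quantifiers (`qfDef_canReach`), by quantifier elimination for linear integer
  arithmetic with floor division (`QFDef.exists_int`) and linear rational arithmetic
  (`QFDef.exists_rat`). Quantifier-free predicates are primitive recursive (`QFDef.primrecPred`).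

The bound, the table of transitions and the quantifier-free predicates depend on `ψ` only, so they
are part of the algorithm for `ψ`; they are not computed from `ψ`.
-/

namespace ALTLf

noncomputable section

open scoped Classical

/-! ### Quantifier elimination -/

/-- The functions of an assignment that are given by linear terms, where integer terms may in
addition be divided by positive constants, rounding down. -/
inductive IsTerm {X : Srt → Type} : (s : Srt) → (Assign X → Dom s) → Prop
  | var (s : Srt) (x : X s) : IsTerm s fun ν => ν s x
  | const (s : Srt) (k : Dom s) : IsTerm s fun _ => k
  | add {s : Srt} {f g : Assign X → Dom s} :
      IsTerm s f → IsTerm s g → IsTerm s fun ν => f ν + g ν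
  | smul {s : Srt} (k : Dom s) {f : Assign X → Dom s} : IsTerm s f → IsTerm s fun ν => k * f ν
  | floorDiv {m : ℤ} (hm : 0 < m) {f : Assign X → ℤ} :
      IsTerm .int f → IsTerm .int fun ν => (f ν / m : ℤ)

/-- The predicates on assignments that are definable by quantifier-free formulas: Boolean
combinations of strict inequalities between terms. -/
inductive QFDef {X : Srt → Type} : (Assign X → Prop) → Prop
  | lt {s : Srt} {f g : Assign X → Dom s} : IsTerm s f → IsTerm s g → QFDef fun ν => f ν < g ν
  | not {S : Assign X → Prop} : QFDef S → QFDef fun ν => ¬ S ν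
  | and {S T : Assign X → Prop} : QFDef S → QFDef T → QFDef fun ν => S ν ∧ T ν

variable {X Y : Srt → Type}

theorem IsTerm.comp {s : Srt} {f : Assign Y → Dom s} (hf : IsTerm s f) {σ : Assign X → Assign Y}
    (hσ : ∀ s y, IsTerm s fun ν => σ ν s y) : IsTerm s fun ν => f (σ ν) := by
  induction hf with
  | var s x => exact hσ s x
  | const s k => exact .const s k
  | add _ _ ih₁ ih₂ => exact .add ih₁ ih₂
  | smul k _ ih => exact .smul k ih
  | floorDiv hm _ ih => exact .floorDiv hm ih

theorem QFDef.comp {S : Assign Y → Prop} (hS : QFDef S) {σ : Assign X → Assign Y}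
    (hσ : ∀ s y, IsTerm s fun ν => σ ν s y) : QFDef fun ν => S (σ ν) := by
  induction hS with
  | lt hf hg => exact .lt (hf.comp hσ) (hg.comp hσ)
  | not _ ih => exact .not ih
  | and _ _ ih₁ ih₂ => exact .and ih₁ ih₂

theorem QFDef.congr {S T : Assign X → Prop} (hS : QFDef S) (h : ∀ ν, T ν ↔ S ν) : QFDef T := by
  rwa [show T = S from funext fun ν => propext (h ν)]

theorem QFDef.or {S T : Assign X → Prop} (hS : QFDef S) (hT : QFDef T) :
    QFDef fun ν => S ν ∨ T ν :=
  (hS.not.and hT.not).not.congr fun ν => by tauto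

theorem QFDef.false : QFDef fun _ : Assign X => False :=
  (QFDef.lt (.const .int (0 : ℤ)) (.const .int (0 : ℤ))).congr fun _ => by
    simp only [lt_self_iff_false]

theorem QFDef.const (p : Prop) : QFDef fun _ : Assign X => p := by
  by_cases hp : p
  · exact QFDef.false.not.congr fun _ => by simp [hp]
  · exact QFDef.false.congr fun _ => by simp [hp]

theorem QFDef.exists_mem {ι : Type*} {W : Set ι} (hW : W.Finite) {S : ι → Assign X → Prop}
    (hS : ∀ w ∈ W, QFDef (S w)) : QFDef fun ν => ∃ w ∈ W, S w ν := by
  induction W, hW using Set.Finite.induction_on with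
  | empty => exact QFDef.false.congr fun ν => by simp
  | insert _ _ ih =>
    exact ((hS _ (Set.mem_insert _ _)).or
      (ih fun w hw => hS w (Set.mem_insert_of_mem _ hw))).congr fun ν => by simp

theorem QFDef.forall_mem {ι : Type*} {W : Set ι} (hW : W.Finite) {S : ι → Assign X → Prop}
    (hS : ∀ w ∈ W, QFDef (S w)) : QFDef fun ν => ∀ w ∈ W, S w ν :=
  (QFDef.exists_mem hW fun w hw => (hS w hw).not).not.congr fun ν => by simp

theorem QFDef.le {s : Srt} {f g : Assign X → Dom s} (hf : IsTerm s f) (hg : IsTerm s g) :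
    QFDef fun ν => f ν ≤ g ν :=
  (QFDef.lt hg hf).not.congr fun ν => by simp only [not_lt]

theorem QFDef.eq {s : Srt} {f g : Assign X → Dom s} (hf : IsTerm s f) (hg : IsTerm s g) :
    QFDef fun ν => f ν = g ν :=
  ((QFDef.le hf hg).and (QFDef.le hg hf)).congr fun ν => by simp only [le_antisymm_iff]

/-- The assignment with the value of one variable changed. -/
def Assign.set (ν : Assign X) (s : Srt) (x : X s) (d : Dom s) : Assign X :=
  Function.update ν s (Function.update (ν s) x d)

theorem Assign.set_same (ν : Assign X) (s : Srt) (x : X s) (d : Dom s) : ν.set s x d s x = d := by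
  simp [Assign.set]

theorem Assign.set_of_ne (ν : Assign X) (s : Srt) (x y : X s) (d : Dom s) (h : y ≠ x) :
    ν.set s x d s y = ν s y := by
  simp [Assign.set, h]

theorem Assign.set_of_sort_ne (ν : Assign X) (s t : Srt) (x : X s) (y : X t) (d : Dom s)
    (h : t ≠ s) : ν.set s x d t y = ν t y := by
  simp [Assign.set, h]

theorem IsTerm.set {s : Srt} (x : X s) {w : Assign X → Dom s} (hw : IsTerm s w) (t : Srt)
    (y : X t) : IsTerm t fun ν : Assign X => ν.set s x (w ν) t y := by
  by_cases hts : t = s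
  · subst hts
    by_cases hyx : y = x
    · subst hyx
      simpa only [Assign.set_same] using hw
    · simpa only [Assign.set_of_ne _ _ _ _ _ hyx] using IsTerm.var t y
  · simpa only [Assign.set_of_sort_ne _ _ _ _ _ _ hts] using IsTerm.var t y

/-- A quantifier can be replaced by a finite disjunction if there are finitely many terms one of
which is a witness whenever there is a witness. -/
theorem QFDef.exists_of_witnesses {S : Assign X → Prop} (hS : QFDef S) (s : Srt) (x : X s)
    {W : Set (Assign X → Dom s)} (hW : W.Finite) (hterm : ∀ w ∈ W, IsTerm s w)
    (h : ∀ (ν : Assign X) (d : Dom s), S (ν.set s x d) → ∃ w ∈ W, S (ν.set s x (w ν))) :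
    QFDef fun ν => ∃ d, S (ν.set s x d) :=
  (QFDef.exists_mem (S := fun w ν => S (ν.set s x (w ν))) hW
    fun w hw => hS.comp (IsTerm.set x (hterm w hw))).congr fun ν =>
    ⟨fun ⟨d, hd⟩ => h ν d hd, fun ⟨w, _, hw⟩ => ⟨w ν, hw⟩⟩

/-! #### Integer quantifiers -/

theorem IsTerm.set_int_of_rat {s : Srt} {f : Assign X → Dom s} (hf : IsTerm s f) (x : X .int)
    (hs : s = .rat) (ν : Assign X) (d d' : ℤ) : f (ν.set .int x d) = f (ν.set .int x d') := by
  induction hf with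
  | var t y =>
    subst hs
    beta_reduce
    rw [Assign.set_of_sort_ne _ _ _ _ _ _ Srt.noConfusion,
      Assign.set_of_sort_ne _ _ _ _ _ _ Srt.noConfusion]
  | const t k => rfl
  | add _ _ ih₁ ih₂ => beta_reduce; rw [ih₁ hs, ih₂ hs]
  | smul k _ ih => beta_reduce; rw [ih hs]
  | floorDiv hm _ ih => cases hs

theorem add_mul_of_shift {h : ℤ → ℤ} {D c : ℤ} (H : ∀ d, h (d + D) = h d + c) (k d : ℤ) :
    h (d + D * k) = h d + c * k := by
  induction k with
  | zero => simp
  | succ i ih => rw [mul_add, mul_add, ← add_assoc, mul_one, H, ih]; ring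
  | pred i ih =>
    have := H (d + D * (-(i : ℤ) - 1))
    rw [show d + D * (-(i : ℤ) - 1) + D = d + D * -(i : ℤ) by ring, ih] at this
    linarith

/-- Integer terms are quasi-linear in each variable: when the variable grows by a suitable period,
the term grows by a constant. The sort is a variable with a hypothesis, for the sake of induction
over terms. -/
theorem IsTerm.exists_shift {s : Srt} {f : Assign X → Dom s} (hf : IsTerm s f) (x : X .int)
    (hs : s = .int) : ∃ D c : ℤ, 0 < D ∧ ∀ (ν : Assign X) (d : ℤ),
      (hs ▸ f (ν.set .int x (d + D)) : Dom .int) = ((hs ▸ f (ν.set .int x d) : Dom .int) + c : ℤ) := by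
  induction hf with
  | var t y =>
    subst hs
    by_cases hyx : y = x
    · subst hyx
      exact ⟨1, 1, one_pos, fun ν d => by simp only [Assign.set_same]⟩
    · exact ⟨1, 0, one_pos, fun ν d => by simp only [Assign.set_of_ne _ _ _ _ _ hyx, add_zero]⟩
  | const t k => subst hs; exact ⟨1, 0, one_pos, fun ν d => (add_zero (_ : ℤ)).symm⟩
  | @add s f g _ _ ih₁ ih₂ =>
    subst hs
    obtain ⟨D₁, c₁, h₁, H₁⟩ := ih₁ rfl
    obtain ⟨D₂, c₂, h₂, H₂⟩ := ih₂ rfl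
    refine ⟨D₁ * D₂, c₁ * D₂ + c₂ * D₁, mul_pos h₁ h₂, fun ν d => ?_⟩
    have e₁ := add_mul_of_shift (h := fun d => f (ν.set .int x d)) (H₁ ν) D₂ d
    have e₂ := add_mul_of_shift (h := fun d => g (ν.set .int x d)) (H₂ ν) D₁ d
    rw [mul_comm D₂ D₁] at e₂
    change (f _ + g _ : ℤ) = (f _ + g _ : ℤ) + _
    rw [show (f _ : ℤ) = _ from e₁, show (g _ : ℤ) = _ from e₂]
    ring
  | @smul s k f _ ih =>
    subst hs
    obtain ⟨D, c, h, H⟩ := ih rfl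
    refine ⟨D, (k : ℤ) * c, h, fun ν d => ?_⟩
    change (k * f _ : ℤ) = (k * f _ : ℤ) + _
    rw [show (f _ : ℤ) = _ from H ν d, mul_add]
  | @floorDiv m hm f _ ih =>
    obtain ⟨D, c, h, H⟩ := ih rfl
    refine ⟨D * m, c, mul_pos h hm, fun ν d => ?_⟩
    have e := add_mul_of_shift (h := fun d => f (ν.set .int x d)) (H ν) m d
    change (f _ / m : ℤ) = (f _ / m : ℤ) + c
    rw [show (f _ : ℤ) = _ from e, Int.add_mul_ediv_right _ _ hm.ne']

/-- For every residue of the quantified integer variable modulo a suitable period, the predicate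
changes its truth value only at the values of finitely many terms. -/
theorem QFDef.exists_thresholds_int {S : Assign X → Prop} (hS : QFDef S) (x : X .int) :
    ∃ D : ℤ, 0 < D ∧ ∃ W : Set (Assign X → ℤ), W.Finite ∧ (∀ w ∈ W, IsTerm .int w) ∧
      ∀ (ν : Assign X) (d d' : ℤ), d % D = d' % D → (∀ w ∈ W, d ≤ w ν ↔ d' ≤ w ν) →
        (S (ν.set .int x d) ↔ S (ν.set .int x d')) := by
  induction hS with
  | @lt s f g hf hg =>
    cases s with
    | rat =>
      refine ⟨1, one_pos, ∅, Set.finite_empty, by simp, fun ν d d' _ _ => ?_⟩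
      beta_reduce
      rw [hf.set_int_of_rat x rfl ν d d', hg.set_int_of_rat x rfl ν d d']
    | int =>
      obtain ⟨D₁, c₁, h₁, H₁⟩ := hf.exists_shift x rfl
      obtain ⟨D₂, c₂, h₂, H₂⟩ := hg.exists_shift x rfl
      -- the difference of both sides has period `D` and increment `c`
      obtain ⟨D, c, hD, H⟩ : ∃ D c : ℤ, 0 < D ∧ ∀ (ν : Assign X) (d k : ℤ),
          (g (ν.set .int x (d + D * k)) - f (ν.set .int x (d + D * k)) : ℤ) =
            (g (ν.set .int x d) - f (ν.set .int x d) : ℤ) + c * k := by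
        refine ⟨D₁ * D₂, c₂ * D₁ - c₁ * D₂, mul_pos h₁ h₂, fun ν d k => ?_⟩
        have e₁ := add_mul_of_shift (h := fun d => f (ν.set .int x d)) (H₁ ν) (D₂ * k) d
        have e₂ := add_mul_of_shift (h := fun d => g (ν.set .int x d)) (H₂ ν) (D₁ * k) d
        rw [show D₂ * (D₁ * k) = D₁ * D₂ * k by ring] at e₂
        rw [show D₁ * (D₂ * k) = D₁ * D₂ * k by ring] at e₁
        rw [show (f _ : ℤ) = _ from e₁, show (g _ : ℤ) = _ from e₂]
        ring
      have hlt : ∀ (ν : Assign X) (d : ℤ), (f (ν.set .int x d) < g (ν.set .int x d)) ↔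
          (0 : ℤ) < (g (ν.set .int x (d % D)) - f (ν.set .int x (d % D)) : ℤ) + c * (d / D) :=
        fun ν d => by
          rw [← H ν (d % D) (d / D), Int.emod_add_mul_ediv]
          exact (sub_pos (a := (g (ν.set .int x d) : ℤ)) (b := (f (ν.set .int x d) : ℤ))).symm
      -- the number of periods up to the threshold for the residue `r`
      have hK : ∃ K : ℤ → Assign X → ℤ, (∀ r, IsTerm .int (K r)) ∧ ∀ (ν : Assign X) (r k k' : ℤ),
          (k ≤ K r ν ↔ k' ≤ K r ν) →
          ((0 : ℤ) < (g (ν.set .int x r) - f (ν.set .int x r) : ℤ) + c * k ↔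
            (0 : ℤ) < (g (ν.set .int x r) - f (ν.set .int x r) : ℤ) + c * k') := by
        have hdiff : ∀ r : ℤ, IsTerm .int fun ν : Assign X =>
            (g (ν.set .int x r) + (-1) * f (ν.set .int x r) : ℤ) := fun r =>
          (hg.comp (IsTerm.set x (.const .int r))).add
            ((hf.comp (IsTerm.set x (.const .int r))).smul (s := .int) (-1 : ℤ))
        rcases lt_trichotomy c 0 with hc | hc | hc
        · refine ⟨fun r ν => ((g (ν.set .int x r) + (-1) * f (ν.set .int x r) : ℤ) + (-1)) / (-c),
            fun r => ((hdiff r).add (.const .int (-1 : ℤ))).floorDiv (by omega),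
            fun ν r k k' hk => ?_⟩
          simp only [Int.le_ediv_iff_mul_le (show 0 < -c by omega)] at hk
          generalize (g (ν.set .int x r) : ℤ) = G at *
          generalize (f (ν.set .int x r) : ℤ) = F at *
          rw [mul_comm k, mul_comm k', neg_mul c, neg_mul c] at hk
          omega
        · refine ⟨fun _ _ => (0 : ℤ), fun _ => .const .int (0 : ℤ), fun ν r k k' _ => ?_⟩
          subst hc
          simp
        · refine ⟨fun r ν => ((-1) * (g (ν.set .int x r) + (-1) * f (ν.set .int x r) : ℤ)) / c,
            fun r => ((hdiff r).smul (s := .int) (-1 : ℤ)).floorDiv hc,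
            fun ν r k k' hk => ?_⟩
          simp only [Int.le_ediv_iff_mul_le hc] at hk
          generalize (g (ν.set .int x r) : ℤ) = G at *
          generalize (f (ν.set .int x r) : ℤ) = F at *
          rw [mul_comm k, mul_comm k'] at hk
          omega
      obtain ⟨K, hKt, hK⟩ := hK
      refine ⟨D, hD, (fun r ν => D * K r ν + r) '' Set.Ico 0 D, (Set.finite_Ico _ _).image _, ?_,
        fun ν d d' hdd hW => ?_⟩
      · rintro _ ⟨r, _, rfl⟩
        exact ((hKt r).smul (s := .int) D).add (.const .int r)
      · beta_reduce
        rw [hlt, hlt, ← hdd]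
        apply hK
        have := hW _ ⟨d % D, ⟨Int.emod_nonneg _ hD.ne', Int.emod_lt_of_pos _ hD⟩, rfl⟩
        have key : ∀ e : ℤ, e % D = d % D → (e ≤ D * K (d % D) ν + d % D ↔ e / D ≤ K (d % D) ν) :=
          fun e he => by
            conv_lhs => rw [← Int.mul_ediv_add_emod e D, he]
            rw [add_le_add_iff_right, mul_le_mul_iff_right₀ hD]
        rwa [key d rfl, key d' hdd.symm] at this
  | not _ ih =>
    obtain ⟨D, hD, W, hW, ht, H⟩ := ih
    exact ⟨D, hD, W, hW, ht, fun ν d d' h h' => not_congr (H ν d d' h h')⟩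
  | and _ _ ih₁ ih₂ =>
    obtain ⟨D₁, hD₁, W₁, hW₁, ht₁, H₁⟩ := ih₁
    obtain ⟨D₂, hD₂, W₂, hW₂, ht₂, H₂⟩ := ih₂
    refine ⟨D₁ * D₂, mul_pos hD₁ hD₂, W₁ ∪ W₂, hW₁.union hW₂,
      fun w hw => hw.elim (ht₁ w) (ht₂ w), fun ν d d' h h' => and_congr
        (H₁ ν d d' ?_ fun w hw => h' w (.inl hw)) (H₂ ν d d' ?_ fun w hw => h' w (.inr hw))⟩
    · rw [← Int.emod_emod_of_dvd d (Dvd.intro _ rfl : D₁ ∣ D₁ * D₂), h,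
        Int.emod_emod_of_dvd d' (Dvd.intro _ rfl : D₁ ∣ D₁ * D₂)]
    · rw [← Int.emod_emod_of_dvd d (Dvd.intro_left _ rfl : D₂ ∣ D₁ * D₂), h,
        Int.emod_emod_of_dvd d' (Dvd.intro_left _ rfl : D₂ ∣ D₁ * D₂)]

/-- Cooper's argument: a witness can be moved by multiples of the period to a value within one
period of a threshold. -/
theorem QFDef.exists_int {S : Assign X → Prop} (hS : QFDef S) (x : X .int) :
    QFDef fun ν => ∃ d, S (ν.set .int x d) := by
  obtain ⟨D, hD, W, hW, ht, H⟩ := hS.exists_thresholds_int x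
  refine hS.exists_of_witnesses .int x
    (W := (fun p : (Assign X → ℤ) × ℤ => fun ν => p.1 ν + p.2) ''
      (insert (fun _ => 0) W ×ˢ Set.Icc (-D) D))
    (((hW.insert _).prod (Set.finite_Icc _ _)).image _) ?_ fun ν d hd => ?_
  · rintro _ ⟨⟨w, j⟩, ⟨hw, _⟩, rfl⟩
    refine IsTerm.add (s := .int) ?_ (.const .int j)
    rcases hw with rfl | hw
    · exact .const .int (0 : ℤ)
    · exact ht w hw
  suffices ∃ w ∈ insert (fun _ => 0) W, ∃ j ∈ Set.Icc (-D) D,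
      (w ν + j) % D = (d : ℤ) % D ∧ ∀ w' ∈ W, w ν + j ≤ w' ν ↔ d ≤ w' ν by
    obtain ⟨w, hw, j, hj, h₁, h₂⟩ := this
    exact ⟨_, ⟨(w, j), ⟨hw, hj⟩, rfl⟩, (H ν _ d h₁ h₂).2 hd⟩
  change ℤ at d
  rcases (W ∩ {w | w ν < d}).eq_empty_or_nonempty with hl | hl
  · have hl' : ∀ w ∈ W, d ≤ w ν := fun w hw => by
      by_contra h
      exact (hl ▸ (⟨hw, not_le.1 h⟩ : w ∈ W ∩ {w | w ν < d}) : w ∈ (∅ : Set _))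
    rcases W.eq_empty_or_nonempty with rfl | hne
    · refine ⟨_, Set.mem_insert _ _, d % D, ⟨?_, (Int.emod_lt_of_pos _ hD).le⟩, by simp, by simp⟩
      linarith [Int.emod_nonneg d hD.ne']
    · obtain ⟨w, hw, hmin⟩ := Set.exists_min_image W (fun w => w ν) hW hne
      have h1 := Int.emod_nonneg (w ν - d) hD.ne'
      have h2 := Int.emod_lt_of_pos (w ν - d) hD
      have h3 := Int.mul_ediv_add_emod (w ν - d) D
      refine ⟨w, Set.mem_insert_of_mem _ hw, -((w ν - d) % D), ⟨by linarith, by linarith⟩, ?_, ?_⟩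
      · rw [show w ν + -((w ν - d) % D) = d + D * ((w ν - d) / D) by linarith,
          Int.add_mul_emod_self_left]
      · intro w' hw'
        have := hl' w' hw'
        have := hmin w' hw'
        constructor <;> intro <;> linarith
  · obtain ⟨w, ⟨hw, hwd⟩, hmax⟩ := Set.exists_max_image _ (fun w => w ν)
      (hW.subset Set.inter_subset_left) hl
    have hwd : w ν < d := hwd
    have h1 := Int.emod_nonneg (d - w ν - 1) hD.ne'
    have h2 := Int.emod_lt_of_pos (d - w ν - 1) hD
    have h3 := Int.mul_ediv_add_emod (d - w ν - 1) D
    have h4 := mul_nonneg hD.le (Int.ediv_nonneg (show 0 ≤ d - w ν - 1 by linarith) hD.le)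
    refine ⟨w, Set.mem_insert_of_mem _ hw, 1 + (d - w ν - 1) % D, ⟨by linarith, by linarith⟩,
      ?_, ?_⟩
    · rw [show d = w ν + (1 + (d - w ν - 1) % D) + D * ((d - w ν - 1) / D) by linarith,
        Int.add_mul_emod_self_left]
      congr 3
      rw [← show d = w ν + (1 + (d - w ν - 1) % D) + D * ((d - w ν - 1) / D) by linarith]
    · intro w' hw'
      constructor
      · intro h
        by_contra h'
        have := hmax w' ⟨hw', not_le.1 h'⟩
        linarith
      · intro h
        linarith

/-! #### Rational quantifiers -/

theorem IsTerm.set_rat_of_int {s : Srt} {f : Assign X → Dom s} (hf : IsTerm s f) (x : X .rat)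
    (hs : s = .int) (ν : Assign X) (d d' : ℚ) : f (ν.set .rat x d) = f (ν.set .rat x d') := by
  induction hf with
  | var t y =>
    subst hs
    beta_reduce
    rw [Assign.set_of_sort_ne _ _ _ _ _ _ Srt.noConfusion,
      Assign.set_of_sort_ne _ _ _ _ _ _ Srt.noConfusion]
  | const t k => rfl
  | add _ _ ih₁ ih₂ => beta_reduce; rw [ih₁ hs, ih₂ hs]
  | smul k _ ih => beta_reduce; rw [ih hs]
  | floorDiv hm _ ih => beta_reduce; rw [ih rfl]

/-- Rational terms are affine in each variable. -/
theorem IsTerm.exists_slope {s : Srt} {f : Assign X → Dom s} (hf : IsTerm s f) (x : X .rat)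
    (hs : s = .rat) : ∃ c : ℚ, ∀ (ν : Assign X) (d : ℚ),
      (hs ▸ f (ν.set .rat x d) : Dom .rat) =
        ((hs ▸ f (ν.set .rat x (0 : ℚ)) : Dom .rat) + c * d : ℚ) := by
  induction hf with
  | var t y =>
    subst hs
    by_cases hyx : y = x
    · subst hyx
      exact ⟨1, fun ν d => by simp only [Assign.set_same, one_mul, zero_add]⟩
    · exact ⟨0, fun ν d => by simp only [Assign.set_of_ne _ _ _ _ _ hyx, zero_mul, add_zero]⟩
  | const t k =>
    subst hs
    exact ⟨0, fun ν d => by simp only [zero_mul, add_zero]⟩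
  | @add s f g _ _ ih₁ ih₂ =>
    subst hs
    obtain ⟨c₁, H₁⟩ := ih₁ rfl
    obtain ⟨c₂, H₂⟩ := ih₂ rfl
    refine ⟨c₁ + c₂, fun ν d => ?_⟩
    change (f _ + g _ : ℚ) = (f _ + g _ : ℚ) + _
    rw [show (f _ : ℚ) = _ from H₁ ν d, show (g _ : ℚ) = _ from H₂ ν d]
    ring
  | @smul s k f _ ih =>
    subst hs
    obtain ⟨c, H⟩ := ih rfl
    refine ⟨(k : ℚ) * c, fun ν d => ?_⟩
    change (k * f _ : ℚ) = (k * f _ : ℚ) + _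
    rw [show (f _ : ℚ) = _ from H ν d, mul_add, mul_assoc]
  | floorDiv hm _ ih => cases hs

/-- The predicate changes its truth value, as a function of a rational variable, only at the
values of finitely many terms. -/
theorem QFDef.exists_thresholds_rat {S : Assign X → Prop} (hS : QFDef S) (x : X .rat) :
    ∃ W : Set (Assign X → ℚ), W.Finite ∧ (∀ w ∈ W, IsTerm .rat w) ∧
      ∀ (ν : Assign X) (d d' : ℚ), (∀ w ∈ W, (d < w ν ↔ d' < w ν) ∧ (w ν < d ↔ w ν < d')) →
        (S (ν.set .rat x d) ↔ S (ν.set .rat x d')) := by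
  induction hS with
  | @lt s f g hf hg =>
    cases s with
    | int =>
      refine ⟨∅, Set.finite_empty, by simp, fun ν d d' _ => ?_⟩
      beta_reduce
      rw [hf.set_rat_of_int x rfl ν d d', hg.set_rat_of_int x rfl ν d d']
    | rat =>
      obtain ⟨c₁, H₁⟩ := hf.exists_slope x rfl
      obtain ⟨c₂, H₂⟩ := hg.exists_slope x rfl
      have hlt : ∀ (ν : Assign X) (d : ℚ), (f (ν.set .rat x d) < g (ν.set .rat x d)) ↔
          (0 : ℚ) < (g (ν.set .rat x (0 : ℚ)) + (-1) * f (ν.set .rat x (0 : ℚ)) : ℚ)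
            + (c₂ - c₁) * d := fun ν d => by
        have e₁ : (f (ν.set .rat x d) : ℚ) = _ := H₁ ν d
        have e₂ : (g (ν.set .rat x d) : ℚ) = _ := H₂ ν d
        change (f (ν.set .rat x d) : ℚ) < (g (ν.set .rat x d) : ℚ) ↔ _
        rw [e₁, e₂]
        change (f (ν.set .rat x (0 : ℚ)) : ℚ) + _ < (g (ν.set .rat x (0 : ℚ)) : ℚ) + _ ↔ _
        constructor <;> intro h <;> linarith
      have hdiff : IsTerm .rat fun ν : Assign X =>
          (g (ν.set .rat x (0 : ℚ)) + (-1) * f (ν.set .rat x (0 : ℚ)) : ℚ) :=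
        (hg.comp (IsTerm.set x (.const .rat (0 : ℚ)))).add
          ((hf.comp (IsTerm.set x (.const .rat (0 : ℚ)))).smul (s := .rat) (-1 : ℚ))
      generalize c₂ - c₁ = c at hlt
      refine ⟨{fun ν => (-c⁻¹) *
          (g (ν.set .rat x (0 : ℚ)) + (-1) * f (ν.set .rat x (0 : ℚ)) : ℚ)},
        Set.finite_singleton _, ?_, fun ν d d' h => ?_⟩
      · rintro _ rfl
        exact hdiff.smul (s := .rat) _
      · have h' := h _ rfl
        beta_reduce
        rw [hlt, hlt]
        generalize (g (ν.set .rat x (0 : ℚ)) + (-1) * f (ν.set .rat x (0 : ℚ)) : ℚ) = u at h'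
        rcases lt_trichotomy c 0 with hc | rfl | hc
        · have : ∀ e : ℚ, 0 < u + c * e ↔ e < -c⁻¹ * u := fun e => by
            rw [show -c⁻¹ * u = u / (-c) by field_simp, lt_div_iff₀ (neg_pos.2 hc)]
            constructor <;> intro h <;> linarith
          rw [this, this]
          exact h'.1
        · simp
        · have : ∀ e : ℚ, 0 < u + c * e ↔ -c⁻¹ * u < e := fun e => by
            rw [show -c⁻¹ * u = (-u) / c by field_simp, div_lt_iff₀ hc]
            constructor <;> intro h <;> linarith
          rw [this, this]
          exact h'.2
  | not _ ih =>
    obtain ⟨W, hW, ht, H⟩ := ih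
    exact ⟨W, hW, ht, fun ν d d' h => not_congr (H ν d d' h)⟩
  | and _ _ ih₁ ih₂ =>
    obtain ⟨W₁, hW₁, ht₁, H₁⟩ := ih₁
    obtain ⟨W₂, hW₂, ht₂, H₂⟩ := ih₂
    exact ⟨W₁ ∪ W₂, hW₁.union hW₂, fun w hw => hw.elim (ht₁ w) (ht₂ w), fun ν d d' h => and_congr
      (H₁ ν d d' fun w hw => h w (.inl hw)) (H₂ ν d d' fun w hw => h w (.inr hw))⟩

/-- The argument of Ferrante and Rackoff: a witness can be replaced by a threshold, by the mean of
two thresholds, by a threshold plus or minus `1`, or by `0`. -/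
theorem QFDef.exists_rat {S : Assign X → Prop} (hS : QFDef S) (x : X .rat) :
    QFDef fun ν => ∃ d, S (ν.set .rat x d) := by
  obtain ⟨W, hW, ht, H⟩ := hS.exists_thresholds_rat x
  -- the witnesses `(w + w') / 2 + j` with thresholds `w`, `w'` and `j ∈ {-1, 0, 1}`, and `0`
  refine hS.exists_of_witnesses .rat x
    (W := insert (fun _ => (0 : ℚ))
      ((fun p : ((Assign X → ℚ) × (Assign X → ℚ)) × ℚ => fun ν =>
        (1 / 2) * (p.1.1 ν + p.1.2 ν) + p.2) '' ((W ×ˢ W) ×ˢ {-1, 0, 1})))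
    ((((hW.prod hW).prod (by simp)).image _).insert _) ?_ fun ν d hd => ?_
  · rintro _ (rfl | ⟨⟨⟨w, w'⟩, j⟩, ⟨⟨hw, hw'⟩, _⟩, rfl⟩)
    · exact .const .rat (0 : ℚ)
    · exact IsTerm.add (s := .rat) (((ht w hw).add (ht w' hw')).smul (s := .rat) (1 / 2 : ℚ))
        (.const .rat j)
  change ℚ at d
  rcases W.eq_empty_or_nonempty with rfl | hne
  · exact ⟨_, Set.mem_insert _ _, (H ν 0 d (by simp)).2 hd⟩
  suffices ∃ w ∈ W, ∃ w' ∈ W, ∃ j ∈ ({-1, 0, 1} : Set ℚ), ∀ t ∈ W,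
      ((1 / 2) * (w ν + w' ν) + j < t ν ↔ d < t ν) ∧
        (t ν < (1 / 2) * (w ν + w' ν) + j ↔ t ν < d) by
    obtain ⟨w, hw, w', hw', j, hj, h⟩ := this
    exact ⟨_, Set.mem_insert_of_mem _ ⟨((w, w'), j), ⟨⟨hw, hw'⟩, hj⟩, rfl⟩, (H ν _ d h).2 hd⟩
  by_cases he : ∃ w ∈ W, w ν = d
  · obtain ⟨w, hw, rfl⟩ := he
    refine ⟨w, hw, w, hw, 0, by simp, fun t _ => ?_⟩
    rw [show (1 / 2) * (w ν + w ν) + 0 = w ν by ring]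
    simp
  push Not at he
  rcases (W ∩ {w | w ν < d}).eq_empty_or_nonempty with hl | hl
  · obtain ⟨w, hw, hmin⟩ := Set.exists_min_image W (fun w => w ν) hW hne
    refine ⟨w, hw, w, hw, -1, by simp, fun t htW => ?_⟩
    have h₁ := hmin t htW
    have h₂ : d < t ν := lt_of_le_of_ne (not_lt.1 fun h =>
      (hl ▸ (⟨htW, h⟩ : t ∈ W ∩ {w | w ν < d}) : t ∈ (∅ : Set _))) (he t htW).symm
    constructor <;> constructor <;> intro <;> linarith
  · obtain ⟨w, ⟨hw, hwd⟩, hmax⟩ := Set.exists_max_image _ (fun w => w ν)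
      (hW.subset Set.inter_subset_left) hl
    have hwd : w ν < d := hwd
    rcases (W ∩ {w | d < w ν}).eq_empty_or_nonempty with hu | hu
    · refine ⟨w, hw, w, hw, 1, by simp, fun t htW => ?_⟩
      have h₂ : t ν < d := lt_of_le_of_ne (not_lt.1 fun h =>
        (hu ▸ (⟨htW, h⟩ : t ∈ W ∩ {w | d < w ν}) : t ∈ (∅ : Set _))) (he t htW)
      have h₁ := hmax t ⟨htW, h₂⟩
      constructor <;> constructor <;> intro <;> linarith
    · obtain ⟨w', ⟨hw', hwd'⟩, hmin⟩ := Set.exists_min_image _ (fun w => w ν)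
        (hW.subset Set.inter_subset_left) hu
      have hwd' : d < w' ν := hwd'
      refine ⟨w, hw, w', hw', 0, by simp, fun t htW => ?_⟩
      rcases lt_or_gt_of_ne (he t htW) with h | h
      · have := hmax t ⟨htW, h⟩
        constructor <;> constructor <;> intro <;> linarith
      · have := hmin t ⟨htW, h⟩
        constructor <;> constructor <;> intro <;> linarith

theorem QFDef.exists_set {S : Assign X → Prop} (hS : QFDef S) (s : Srt) (x : X s) :
    QFDef fun ν => ∃ d, S (ν.set s x d) := by
  cases s
  · exact hS.exists_int x
  · exact hS.exists_rat x

/-- Elimination of a finite block of quantifiers: the variables in the finite set `Z` are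
quantified. -/
theorem QFDef.exists_block {S : Assign X → Prop} (hS : QFDef S) (Z : Set ((s : Srt) × X s))
    (hZ : Z.Finite) :
    QFDef fun ν => ∃ ν' : Assign X, S ν' ∧ ∀ (s : Srt) (x : X s), ⟨s, x⟩ ∉ Z → ν' s x = ν s x := by
  induction Z, hZ using Set.Finite.induction_on with
  | empty =>
    refine hS.congr fun ν => ⟨?_, fun h => ⟨ν, h, fun _ _ _ => rfl⟩⟩
    rintro ⟨ν', h, h'⟩
    rwa [show ν' = ν from funext fun s => funext fun x => h' s x (by simp)] at h
  | @insert z Z _ _ ih =>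
    obtain ⟨s, x⟩ := z
    refine (ih.exists_set s x).congr fun ν => ⟨?_, ?_⟩
    · rintro ⟨ν', h, h'⟩
      refine ⟨ν' s x, ν', h, fun t y hy => ?_⟩
      by_cases hyx : (⟨t, y⟩ : (s : Srt) × X s) = ⟨s, x⟩
      · cases hyx
        rw [Assign.set_same]
      · rw [h' t y (by simp [hyx, hy])]
        by_cases hts : t = s
        · subst hts
          rw [Assign.set_of_ne _ _ _ _ _ (by simpa using hyx)]
        · rw [Assign.set_of_sort_ne _ _ _ _ _ _ hts]
    · rintro ⟨d, ν', h, h'⟩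
      refine ⟨ν', h, fun t y hy => ?_⟩
      simp only [Set.mem_insert_iff, not_or] at hy
      rw [h' t y hy.2]
      by_cases hts : t = s
      · subst hts
        rw [Assign.set_of_ne _ _ _ _ _ (by simpa using hy.1)]
      · rw [Assign.set_of_sort_ne _ _ _ _ _ _ hts]

theorem Expr.isTerm_eval {s : Srt} (e : Expr X s) : IsTerm s fun ν : Assign X => e.eval ν := by
  induction e with
  | var x => exact .var s x
  | const k => exact .const s k
  | add a b iha ihb => exact .add iha ihb
  | smul k a ih => exact .smul k ih

theorem Cstr.qfDef_holds (c : Cstr X) : QFDef fun ν : Assign X => c.Holds ν := by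
  have hcong : ∀ (m : ℕ) (a b : Expr X .int),
      QFDef fun ν : Assign X => Int.ModEq m (a.eval ν) (b.eval ν) := fun m a b => by
    rcases Nat.eq_zero_or_pos m with rfl | hm
    · exact (QFDef.eq a.isTerm_eval b.isTerm_eval).congr fun ν => by simp [Int.ModEq]
    · have hm' : (0 : ℤ) < m := by exact_mod_cast hm
      have hd : IsTerm .int fun ν : Assign X => ((b.eval ν : ℤ) + (-1) * (a.eval ν : ℤ) : ℤ) :=
        b.isTerm_eval.add (a.isTerm_eval.smul (s := .int) (-1 : ℤ))
      refine (QFDef.eq hd ((hd.floorDiv hm').smul (s := .int) (m : ℤ))).congr fun ν => ?_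
      rw [Int.modEq_iff_dvd]
      change _ ↔ ((b.eval ν : ℤ) + (-1) * (a.eval ν : ℤ) : ℤ) =
        (m : ℤ) * (((b.eval ν : ℤ) + (-1) * (a.eval ν : ℤ)) / m : ℤ)
      rw [neg_one_mul, ← sub_eq_add_neg, eq_comm]
      exact ⟨fun h => Int.mul_ediv_cancel' h, fun h => ⟨_, h.symm⟩⟩
  cases c with
  | eq s a b => exact QFDef.eq a.isTerm_eval b.isTerm_eval
  | ne s a b => exact (QFDef.eq a.isTerm_eval b.isTerm_eval).not
  | lt s a b => exact QFDef.lt a.isTerm_eval b.isTerm_eval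
  | le s a b => exact QFDef.le a.isTerm_eval b.isTerm_eval
  | cong m a b => exact hcong m a b
  | ncong m a b => exact (hcong m a b).not

/-! ### Computability of quantifier-free predicates -/

section Computability

variable {γ : Type*} [Primcodable γ]

/-- The integer-valued function is the difference of two primitive recursive functions. -/
def PrimrecInt (f : γ → ℤ) : Prop :=
  ∃ p q : γ → ℕ, Primrec p ∧ Primrec q ∧ ∀ c, f c = p c - q c

/-- The rational-valued function is a fraction whose numerator is a difference of primitive
recursive functions and whose denominator is the successor of one. -/
def PrimrecRat (f : γ → ℚ) : Prop :=
  ∃ p q r : γ → ℕ, Primrec p ∧ Primrec q ∧ Primrec r ∧ ∀ c, f c = (p c - q c) / (r c + 1)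

/-- Primitive recursiveness of functions with values in the domain of a sort. -/
def PrimrecDom : (s : Srt) → (γ → Dom s) → Prop
  | .int => PrimrecInt
  | .rat => PrimrecRat

theorem PrimrecInt.add {f g : γ → ℤ} (hf : PrimrecInt f) (hg : PrimrecInt g) :
    PrimrecInt fun c => f c + g c := by
  obtain ⟨p, q, hp, hq, h⟩ := hf
  obtain ⟨p', q', hp', hq', h'⟩ := hg
  refine ⟨fun c => p c + p' c, fun c => q c + q' c, Primrec.nat_add.comp hp hp',
    Primrec.nat_add.comp hq hq', fun c => ?_⟩
  beta_reduce
  rw [h, h']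
  push_cast
  ring

theorem PrimrecInt.mul {f g : γ → ℤ} (hf : PrimrecInt f) (hg : PrimrecInt g) :
    PrimrecInt fun c => f c * g c := by
  obtain ⟨p, q, hp, hq, h⟩ := hf
  obtain ⟨p', q', hp', hq', h'⟩ := hg
  refine ⟨fun c => p c * p' c + q c * q' c, fun c => p c * q' c + q c * p' c,
    Primrec.nat_add.comp (Primrec.nat_mul.comp hp hp') (Primrec.nat_mul.comp hq hq'),
    Primrec.nat_add.comp (Primrec.nat_mul.comp hp hq') (Primrec.nat_mul.comp hq hp'),
    fun c => ?_⟩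
  beta_reduce
  rw [h, h']
  push_cast
  ring

theorem PrimrecInt.const (k : ℤ) : PrimrecInt fun _ : γ => k :=
  ⟨fun _ => k.toNat, fun _ => (-k).toNat, Primrec.const _, Primrec.const _, fun _ => by
    beta_reduce
    omega⟩

theorem PrimrecInt.ediv {f : γ → ℤ} (hf : PrimrecInt f) {m : ℤ} (hm : 0 < m) :
    PrimrecInt fun c => f c / m := by
  obtain ⟨p, q, hp, hq, h⟩ := hf
  obtain ⟨m, rfl⟩ := Int.eq_ofNat_of_zero_le hm.le
  have hm' : 0 < m := by exact_mod_cast hm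
  -- for `p < q`, the quotient is the negative of `(q - p) / m`, rounded up
  refine ⟨fun c => (p c - q c) / m, fun c => (q c - p c + (m - 1)) / m,
    Primrec.nat_div.comp (Primrec.nat_sub.comp hp hq) (Primrec.const m),
    Primrec.nat_div.comp (Primrec.nat_add.comp (Primrec.nat_sub.comp hq hp)
      (Primrec.const (m - 1))) (Primrec.const m), fun c => ?_⟩
  beta_reduce
  rw [h]
  rcases le_total (q c) (p c) with hle | hle
  · rw [Nat.sub_eq_zero_of_le hle, Nat.div_eq_of_lt (by omega : 0 + (m - 1) < m)]
    push_cast [hle]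
    simp
  · rw [Nat.sub_eq_zero_of_le hle, Nat.zero_div]
    push_cast [hle, Nat.one_le_iff_ne_zero.2 hm'.ne']
    have h1 := Int.mul_ediv_add_emod ((p c : ℤ) - q c) m
    have h2 := Int.emod_nonneg ((p c : ℤ) - q c) hm.ne'
    have h3 := Int.emod_lt_of_pos ((p c : ℤ) - q c) hm
    have : ((q c : ℤ) - p c + (m - 1)) / m = -(((p c : ℤ) - q c) / m) := by
      rw [show ((q c : ℤ) - p c + (m - 1)) =
        (m - 1 - ((p c : ℤ) - q c) % m) + m * -(((p c : ℤ) - q c) / m) by linarith,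
        Int.add_mul_ediv_left _ _ hm.ne', Int.ediv_eq_zero_of_lt (by linarith) (by linarith),
        zero_add]
    rw [this]
    ring

theorem PrimrecInt.lt {f g : γ → ℤ} (hf : PrimrecInt f) (hg : PrimrecInt g) :
    PrimrecPred fun c => f c < g c := by
  obtain ⟨p, q, hp, hq, h⟩ := hf
  obtain ⟨p', q', hp', hq', h'⟩ := hg
  refine (Primrec.nat_lt.comp (Primrec.nat_add.comp hp hq') (Primrec.nat_add.comp hp' hq)).of_eq
    fun c => ?_
  rw [h, h']
  omega

theorem PrimrecRat.add {f g : γ → ℚ} (hf : PrimrecRat f) (hg : PrimrecRat g) :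
    PrimrecRat fun c => f c + g c := by
  obtain ⟨p, q, r, hp, hq, hr, h⟩ := hf
  obtain ⟨p', q', r', hp', hq', hr', h'⟩ := hg
  have hs := Primrec.succ.comp hr
  have hs' := Primrec.succ.comp hr'
  refine ⟨fun c => p c * (r' c + 1) + p' c * (r c + 1), fun c => q c * (r' c + 1) + q' c * (r c + 1),
    fun c => r c * (r' c + 1) + r' c,
    Primrec.nat_add.comp (Primrec.nat_mul.comp hp hs') (Primrec.nat_mul.comp hp' hs),
    Primrec.nat_add.comp (Primrec.nat_mul.comp hq hs') (Primrec.nat_mul.comp hq' hs),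
    Primrec.nat_add.comp (Primrec.nat_mul.comp hr hs') hr', fun c => ?_⟩
  beta_reduce
  rw [h, h']
  have h1 : (r c : ℚ) + 1 ≠ 0 := by positivity
  have h2 : (r' c : ℚ) + 1 ≠ 0 := by positivity
  push_cast
  rw [show (r c : ℚ) * (r' c + 1) + r' c + 1 = (r c + 1) * (r' c + 1) by ring]
  field_simp
  ring

theorem PrimrecRat.mul {f g : γ → ℚ} (hf : PrimrecRat f) (hg : PrimrecRat g) :
    PrimrecRat fun c => f c * g c := by
  obtain ⟨p, q, r, hp, hq, hr, h⟩ := hf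
  obtain ⟨p', q', r', hp', hq', hr', h'⟩ := hg
  refine ⟨fun c => p c * p' c + q c * q' c, fun c => p c * q' c + q c * p' c,
    fun c => r c * (r' c + 1) + r' c,
    Primrec.nat_add.comp (Primrec.nat_mul.comp hp hp') (Primrec.nat_mul.comp hq hq'),
    Primrec.nat_add.comp (Primrec.nat_mul.comp hp hq') (Primrec.nat_mul.comp hq hp'),
    Primrec.nat_add.comp (Primrec.nat_mul.comp hr (Primrec.succ.comp hr')) hr', fun c => ?_⟩
  beta_reduce
  rw [h, h']
  have h1 : (r c : ℚ) + 1 ≠ 0 := by positivity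
  have h2 : (r' c : ℚ) + 1 ≠ 0 := by positivity
  push_cast
  rw [show (r c : ℚ) * (r' c + 1) + r' c + 1 = (r c + 1) * (r' c + 1) by ring]
  field_simp
  ring

theorem PrimrecRat.const (k : ℚ) : PrimrecRat fun _ : γ => k := by
  refine ⟨fun _ => k.num.toNat, fun _ => (-k.num).toNat, fun _ => k.den - 1, Primrec.const _,
    Primrec.const _, Primrec.const _, fun _ => ?_⟩
  have h1 : ((k.num.toNat : ℚ) - ((-k.num).toNat : ℚ)) = (k.num : ℚ) := by
    exact_mod_cast (by omega : ((k.num.toNat : ℤ) - ((-k.num).toNat : ℤ)) = k.num)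
  rw [h1, Nat.cast_sub k.den_pos, Nat.cast_one, sub_add_cancel, Rat.num_div_den]

theorem PrimrecRat.lt {f g : γ → ℚ} (hf : PrimrecRat f) (hg : PrimrecRat g) :
    PrimrecPred fun c => f c < g c := by
  obtain ⟨p, q, r, hp, hq, hr, h⟩ := hf
  obtain ⟨p', q', r', hp', hq', hr', h'⟩ := hg
  have hs := Primrec.succ.comp hr
  have hs' := Primrec.succ.comp hr'
  refine (Primrec.nat_lt.comp
    (Primrec.nat_add.comp (Primrec.nat_mul.comp hp hs') (Primrec.nat_mul.comp hq' hs))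
    (Primrec.nat_add.comp (Primrec.nat_mul.comp hp' hs) (Primrec.nat_mul.comp hq hs'))).of_eq
    fun c => ?_
  rw [h, h', div_lt_div_iff₀ (by positivity) (by positivity), ← Nat.cast_lt (α := ℚ)]
  push_cast
  constructor <;> intro h <;> linarith

theorem IsTerm.primrecDom {X : Srt → Type} {dec : γ → Assign X}
    (hdec : ∀ s x, PrimrecDom s fun c => dec c s x) {s : Srt} {f : Assign X → Dom s}
    (hf : IsTerm s f) : PrimrecDom s fun c => f (dec c) := by
  induction hf with
  | var s x => exact hdec s x
  | const s k =>
    cases s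
    · exact PrimrecInt.const k
    · exact PrimrecRat.const k
  | @add s f g _ _ ih₁ ih₂ =>
    cases s
    · exact PrimrecInt.add ih₁ ih₂
    · exact PrimrecRat.add ih₁ ih₂
  | @smul s k f _ ih =>
    cases s
    · exact PrimrecInt.mul (.const k) ih
    · exact PrimrecRat.mul (.const k) ih
  | floorDiv hm _ ih => exact PrimrecInt.ediv ih hm

theorem QFDef.primrecPred {X : Srt → Type} {dec : γ → Assign X}
    (hdec : ∀ s x, PrimrecDom s fun c => dec c s x) {S : Assign X → Prop} (hS : QFDef S) :
    PrimrecPred fun c => S (dec c) := by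
  induction hS with
  | @lt s f g hf hg =>
    cases s
    · exact PrimrecInt.lt (hf.primrecDom hdec) (hg.primrecDom hdec)
    · exact PrimrecRat.lt (hf.primrecDom hdec) (hg.primrecDom hdec)
  | not _ ih => exact ih.not
  | and _ _ ih₁ ih₂ => exact ih₁.and ih₂

theorem PrimrecInt.of_primrec {f : γ → ℤ} (hf : Primrec f) : PrimrecInt f := by
  have hp : PrimrecPred fun c => Encodable.encode (f c) % 2 = 0 :=
    Primrec.eq.comp (Primrec.nat_mod.comp (Primrec.encode.comp hf) (Primrec.const 2))
      (Primrec.const 0)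
  have hd : Primrec fun c => Encodable.encode (f c) / 2 :=
    Primrec.nat_div.comp (Primrec.encode.comp hf) (Primrec.const 2)
  refine ⟨_, _, Primrec.ite hp hd (Primrec.const 0),
    Primrec.ite hp (Primrec.const 0) (Primrec.succ.comp hd), fun c => ?_⟩
  -- the code of a nonnegative integer `k` is `2 k`, and the code of `-(k + 1)` is `2 k + 1`
  rcases hz : f c with k | k
  · have : Encodable.encode (Int.ofNat k) = 2 * k := rfl
    rw [this]
    simp
  · have : Encodable.encode (Int.negSucc k) = 2 * k + 1 := rfl
    rw [this]
    have h1 : (2 * k + 1) % 2 ≠ 0 := by omega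
    have h2 : (2 * k + 1) / 2 = k := by omega
    rw [if_neg h1, if_neg h1, h2]
    simp [Int.negSucc_eq]

theorem PrimrecRat.of_primrec {f : γ → ℤ × ℕ} (hf : Primrec f) :
    PrimrecRat fun c => ((f c).1 : ℚ) / (((f c).2 : ℚ) + 1) := by
  obtain ⟨p, q, hp, hq, h⟩ := PrimrecInt.of_primrec (Primrec.fst.comp hf)
  refine ⟨p, q, fun c => (f c).2, hp, hq, Primrec.snd.comp hf, fun c => ?_⟩
  have h' : (f c).1 = (p c - q c : ℤ) := h c
  beta_reduce
  rw [h']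
  push_cast
  rfl

/-- A function to a finite type is primitive recursive if its fibres are. -/
theorem Primrec.of_fibers {σ : Type*} [Primcodable σ] [Finite σ] {f : γ → σ}
    (hf : ∀ v, PrimrecPred fun c => f c = v) : Primrec f := by
  suffices ∀ W : Set σ, W.Finite → ∀ v₀ : σ,
      Primrec fun c => if f c ∈ W then f c else v₀ by
    rcases isEmpty_or_nonempty σ with hσ | ⟨⟨v₀⟩⟩
    · have : IsEmpty γ := ⟨fun c => hσ.false (f c)⟩
      exact Primrec.dom_finite f
    · simpa using this Set.univ Set.finite_univ v₀
  intro W hW v₀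
  induction W, hW using Set.Finite.induction_on with
  | empty => simpa using Primrec.const v₀
  | @insert v W _ _ ih =>
    refine (Primrec.ite (hf v) (Primrec.const v) ih).of_eq fun c => ?_
    by_cases h : f c = v
    · simp [h]
    · simp [h]

theorem PrimrecPred.exists_mem {ι : Type*} {W : Set ι} (hW : W.Finite) {S : ι → γ → Prop}
    (hS : ∀ w ∈ W, PrimrecPred (S w)) : PrimrecPred fun c => ∃ w ∈ W, S w c := by
  induction W, hW using Set.Finite.induction_on with
  | empty => exact ⟨fun _ => .isFalse (by simp), (Primrec.const false).of_eq fun c => by simp⟩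
  | insert _ _ ih =>
    exact ((hS _ (Set.mem_insert _ _)).or
      (ih fun w hw => hS w (Set.mem_insert_of_mem _ hw))).of_eq fun ν => by simp

/-- The assignment represented by finite data. -/
def decodeAssign {n : Srt → ℕ} (a : (Fin (n .int) → ℤ) × (Fin (n .rat) → ℤ × ℕ)) :
    Assign (Var n) := fun s => match s with
  | .int => fun v => a.1 v
  | .rat => fun v => ((a.2 v).1 : ℚ) / (((a.2 v).2 : ℚ) + 1)

theorem primrecDom_decodeAssign {n : Srt → ℕ}
    {f : γ → (Fin (n .int) → ℤ) × (Fin (n .rat) → ℤ × ℕ)} (hf : Primrec f) (s : Srt)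
    (x : Var n s) : PrimrecDom s fun c => decodeAssign (f c) s x := by
  cases s
  · exact PrimrecInt.of_primrec (Primrec.fin_app.comp (Primrec.fst.comp hf) (Primrec.const x))
  · exact PrimrecRat.of_primrec (Primrec.fin_app.comp (Primrec.snd.comp hf) (Primrec.const x))

end Computability

variable {n : Srt → ℕ}

/-! ### Constraints -/

theorem Cstr.neg_holds {X : Srt → Type} (c : Cstr X) (α : Assign X) :
    c.neg.Holds α ↔ ¬ c.Holds α := by
  cases c with
  | eq s a b => exact Iff.rfl
  | ne s a b => exact not_not.symm
  | lt s a b => exact not_lt.symm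
  | le s a b => exact not_le.symm
  | cong m a b => exact not_congr Int.modEq_comm
  | ncong m a b => exact Int.modEq_comm.trans not_not.symm

theorem Expr.mentions_map {X Y : Srt → Type} {s : Srt} (e : Expr X s)
    (f : (s : Srt) → X s → Y s) (p : (s : Srt) → Y s → Prop) :
    (e.map f).Mentions p ↔ e.Mentions fun s x => p s (f s x) := by
  induction e with
  | var x => exact Iff.rfl
  | const k => exact Iff.rfl
  | add a b iha ihb => exact or_congr iha ihb
  | smul k a ih => exact ih

theorem Cstr.mentions_map {X Y : Srt → Type} (c : Cstr X)
    (f : (s : Srt) → X s → Y s) (p : (s : Srt) → Y s → Prop) :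
    (c.map f).Mentions p ↔ c.Mentions fun s x => p s (f s x) := by
  cases c <;> exact or_congr (Expr.mentions_map _ f p) (Expr.mentions_map _ f p)

theorem Expr.eval_map {X Y : Srt → Type} {s : Srt} (e : Expr X s)
    (f : (s : Srt) → X s → Y s) (α : Assign Y) :
    (e.map f).eval α = e.eval fun s x => α s (f s x) := by
  induction e with
  | var x => rfl
  | const k => rfl
  | add a b iha ihb => simp only [Expr.map, Expr.eval, iha, ihb]
  | smul k a ih => simp only [Expr.map, Expr.eval, ih]

theorem Cstr.holds_map {X Y : Srt → Type} (c : Cstr X)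
    (f : (s : Srt) → X s → Y s) (α : Assign Y) :
    (c.map f).Holds α ↔ c.Holds fun s x => α s (f s x) := by
  cases c <;> simp only [Cstr.map, Cstr.Holds, Expr.eval_map]

theorem Expr.eval_congr {X : Srt → Type} {s : Srt} (e : Expr X s) {p : (s : Srt) → X s → Prop}
    {α β : Assign X} (he : ¬ e.Mentions p) (h : ∀ s x, ¬ p s x → α s x = β s x) :
    e.eval α = e.eval β := by
  induction e with
  | var x => exact h _ _ he
  | const k => rfl
  | add a b iha ihb =>
    simp only [Expr.Mentions, not_or] at he
    simp only [Expr.eval, iha he.1, ihb he.2]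
  | smul k a ih => simp only [Expr.eval, ih he]

theorem Cstr.holds_congr {X : Srt → Type} (c : Cstr X) {p : (s : Srt) → X s → Prop}
    {α β : Assign X} (hc : ¬ c.Mentions p) (h : ∀ s x, ¬ p s x → α s x = β s x) :
    c.Holds α ↔ c.Holds β := by
  cases c <;> simp only [Cstr.Mentions, not_or] at hc <;>
    simp only [Cstr.Holds, Expr.eval_congr _ hc.1 h, Expr.eval_congr _ hc.2 h]

theorem Expr.Mentions.mono {X : Srt → Type} {s : Srt} {e : Expr X s}
    {p q : (s : Srt) → X s → Prop} (h : ∀ s x, p s x → q s x) (he : e.Mentions p) :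
    e.Mentions q := by
  induction e with
  | var x => exact h _ _ he
  | const k => exact he
  | add a b iha ihb => exact he.imp iha ihb
  | smul k a ih => exact ih he

theorem Cstr.Mentions.mono {X : Srt → Type} {c : Cstr X} {p q : (s : Srt) → X s → Prop}
    (h : ∀ s x, p s x → q s x) (hc : c.Mentions p) : c.Mentions q := by
  cases c <;> exact Or.imp (Expr.Mentions.mono h) (Expr.Mentions.mono h) hc

/-! ### Semantics of lookback properties -/

/-- Satisfaction of a lookback property at an instant of a sequence of length `N`, where `ρ i`
assigns the values at the instants `i - 1` and `i` to the variables. -/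
def BSat (N : ℕ) (ρ : ℕ → Assign (BVar n)) : BProp n → ℕ → Prop
  | .tt, _ => True
  | .ff, _ => False
  | .con c, i => c.Holds (ρ i)
  | .ncon c, i => ¬ c.Holds (ρ i)
  | .and a b, i => BSat N ρ a i ∧ BSat N ρ b i
  | .or a b, i => BSat N ρ a i ∨ BSat N ρ b i
  | .snext a, i => i + 1 < N ∧ BSat N ρ a (i + 1)
  | .wnext a, i => i + 1 < N → BSat N ρ a (i + 1)
  | .glob a, i => ∀ j, i ≤ j → j < N → BSat N ρ a j
  | .til a b, i => UntilAt N (BSat N ρ a) (BSat N ρ b) i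

theorem untilAt_iff_exists {N : ℕ} {A B : ℕ → Prop} {i : ℕ} :
    UntilAt N A B i ↔ ∃ k, i ≤ k ∧ k < N ∧ B k ∧ ∀ j, i ≤ j → j < k → A j := by
  constructor
  · intro h
    induction h with
    | @now i hi hB => exact ⟨i, le_rfl, hi, hB, fun j h h' => absurd h' (not_lt.2 h)⟩
    | @later i hi hA _ ih =>
      obtain ⟨k, hk, hkN, hB, hA'⟩ := ih
      refine ⟨k, by omega, hkN, hB, fun j h h' => ?_⟩
      rcases h.eq_or_lt with rfl | h
      · exact hA
      · exact hA' j h h'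
  · rintro ⟨k, hk, hkN, hB, hA⟩
    suffices ∀ m, i ≤ m → m ≤ k → UntilAt N A B m from this i le_rfl hk
    intro m hm hmk
    induction hmk using Nat.decreasingInduction with
    | self => exact .now hkN hB
    | of_succ m hmk ih => exact .later (by omega) (hA m hm hmk) (ih (by omega))

theorem untilAt_iff {N : ℕ} {A B : ℕ → Prop} {i : ℕ} (hi : i < N) :
    UntilAt N A B i ↔ B i ∨ (A i ∧ i + 1 < N ∧ UntilAt N A B (i + 1)) := by
  constructor
  · rintro (⟨_, h⟩ | ⟨h, hA, h'⟩)
    · exact .inl h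
    · exact .inr ⟨hA, h, h'⟩
  · rintro (h | ⟨hA, h, h'⟩)
    · exact .now hi h
    · exact .later h hA h'

theorem not_untilAt_iff {N : ℕ} {A B : ℕ → Prop} {i : ℕ} :
    ¬ UntilAt N A B i ↔ (∀ j, i ≤ j → j < N → ¬ B j) ∨
      UntilAt N (fun j => ¬ B j) (fun j => ¬ A j ∧ ¬ B j) i := by
  constructor
  · intro h
    by_contra! hcon
    obtain ⟨⟨j, hij, hjN, hj⟩, h₂⟩ := hcon
    -- the first instant where `B` holds
    have hex : ∃ k, i ≤ k ∧ B k := ⟨j, hij, hj⟩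
    obtain ⟨hk, hB⟩ := Nat.find_spec hex
    have hmin : ∀ l, i ≤ l → l < Nat.find hex → ¬ B l := fun l hl hl' hBl =>
      Nat.find_min hex hl' ⟨hl, hBl⟩
    have hkN : Nat.find hex < N := (Nat.find_min' hex ⟨hij, hj⟩).trans_lt hjN
    refine h (untilAt_iff_exists.2 ⟨_, hk, hkN, hB, fun l hl hl' => ?_⟩)
    by_contra hA
    exact h₂ (untilAt_iff_exists.2 ⟨l, hl, hl'.trans hkN, ⟨hA, hmin l hl hl'⟩,
      fun m hm hm' => hmin m hm (hm'.trans hl')⟩)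
  · rintro h hU
    obtain ⟨k, hk, hkN, hB, hA⟩ := untilAt_iff_exists.1 hU
    rcases h with h | h
    · exact h k hk hkN hB
    · obtain ⟨l, hl, hlN, ⟨hAl, hBl⟩, h'⟩ := untilAt_iff_exists.1 h
      rcases lt_trichotomy l k with hlk | rfl | hlk
      · exact hAl (hA l hl hlk)
      · exact hBl hB
      · exact h' k hk hlk hB

theorem untilAt_congr {N : ℕ} {A A' B B' : ℕ → Prop} (hA : ∀ i, i < N → (A i ↔ A' i))
    (hB : ∀ i, i < N → (B i ↔ B' i)) (i : ℕ) : UntilAt N A B i ↔ UntilAt N A' B' i := by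
  rw [untilAt_iff_exists, untilAt_iff_exists]
  refine exists_congr fun k => and_congr_right fun _ => and_congr_right fun hk => ?_
  rw [hB k hk]
  refine and_congr_right fun _ => forall_congr' fun j => forall_congr' fun _ =>
    forall_congr' fun hj => hA j (hj.trans hk)

theorem con_lookahead_iff {τ : Seq n} {ρ : ℕ → Assign (BVar n)}
    (hpre : ∀ i s v, ρ (i + 1) s (.pre, v) = τ.getD i (fun _ _ => 0) s v)
    (hcur : ∀ i s v, ρ i s (.cur, v) = τ.getD i (fun _ _ => 0) s v)
    {c : Cstr (LVar n)} (hc : ¬ HasLookaheadGE 2 c) (h1 : HasLookaheadGE 1 c) {i : ℕ}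
    (hi : i < τ.length) :
    (i < τ.length ∧ (¬ WellDefined τ i c ∨ c.Holds (lookaheadAssign τ i))) ↔
      (i + 1 < τ.length → (toPreCur c).Holds (ρ (i + 1))) := by
  have hwd : WellDefined τ i c ↔ i + 1 < τ.length := by
    constructor
    · intro h
      by_contra hlt
      exact h.2 (h1.mono fun s x hx => by omega)
    · intro h
      exact ⟨hi, fun hm => hc (hm.mono fun s x hx => by omega)⟩
  have hholds : (toPreCur c).Holds (ρ (i + 1)) ↔ c.Holds (lookaheadAssign τ i) := by
    rw [toPreCur, Cstr.holds_map]
    refine c.holds_congr hc fun s x hx => ?_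
    obtain ⟨v, j⟩ := x
    have hj : j = 0 ∨ j = 1 := by simp only at hx; omega
    rcases hj with rfl | rfl
    · simpa [lookaheadAssign] using hpre i s v
    · simpa [lookaheadAssign] using hcur (i + 1) s v
  rw [hwd, hholds]
  tauto

theorem con_current_iff {τ : Seq n} {ρ : ℕ → Assign (BVar n)}
    (hcur : ∀ i s v, ρ i s (.cur, v) = τ.getD i (fun _ _ => 0) s v)
    {c : Cstr (LVar n)} (h1 : ¬ HasLookaheadGE 1 c) {i : ℕ} (hi : i < τ.length) :
    (i < τ.length ∧ (¬ WellDefined τ i c ∨ c.Holds (lookaheadAssign τ i))) ↔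
      (toCur c).Holds (ρ i) := by
  have hwd : WellDefined τ i c := ⟨hi, fun hm => h1 (hm.mono fun s x hx => by omega)⟩
  have hholds : (toCur c).Holds (ρ i) ↔ c.Holds (lookaheadAssign τ i) := by
    rw [toCur, Cstr.holds_map]
    refine c.holds_congr h1 fun s x hx => ?_
    obtain ⟨v, j⟩ := x
    obtain rfl : j = 0 := by simp only at hx; omega
    simpa [lookaheadAssign] using hcur i s v
  rw [hholds]
  tauto

/-- The translation to lookback properties in negation normal form preserves satisfaction. -/
theorem bsat_back_iff {τ : Seq n} {ρ : ℕ → Assign (BVar n)}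
    (hpre : ∀ i s v, ρ (i + 1) s (.pre, v) = τ.getD i (fun _ _ => 0) s v)
    (hcur : ∀ i s v, ρ i s (.cur, v) = τ.getD i (fun _ _ => 0) s v)
    {ψ : Property n} (hψ : ψ.LookaheadLE 1) {i : ℕ} (hi : i < τ.length) :
    (BSat τ.length ρ (back true ψ) i ↔ SatAt τ ψ i) ∧
      (BSat τ.length ρ (back false ψ) i ↔ ¬ SatAt τ ψ i) := by
  induction ψ generalizing i with
  | con c =>
    by_cases h1 : HasLookaheadGE 1 c
    · simp only [back, if_pos h1, BSat, SatAt, con_lookahead_iff hpre hcur hψ h1 hi]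
      simp
    · simp only [back, if_neg h1, BSat, SatAt, con_current_iff hcur h1 hi]
      simp
  | and a b iha ihb =>
    simp only [back, BSat, SatAt, iha hψ.1 hi, ihb hψ.2 hi]
    tauto
  | not a ih =>
    simp only [back, SatAt, ih hψ hi]
    simp
  | next a ih =>
    simp only [back, BSat, SatAt]
    by_cases h : i + 1 < τ.length
    · simp [h, ih hψ h]
    · simp [h]
  | til a b iha ihb =>
    simp only [back, BSat, SatAt]
    refine ⟨untilAt_congr (fun j hj => (iha hψ.1 hj).1) (fun j hj => (ihb hψ.2 hj).1) i, ?_⟩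
    rw [not_untilAt_iff]
    refine or_congr (forall_congr' fun j => forall_congr' fun _ => forall_congr' fun hj =>
      (ihb hψ.2 hj).2) (untilAt_congr (fun j hj => (ihb hψ.2 hj).2)
        (fun j hj => and_congr (iha hψ.1 hj).2 (ihb hψ.2 hj).2) i)

/-! ### Propositional simplification -/

/-- The predicate is a valuation: it respects the constants, conjunction and disjunction. -/
structure IsValuation (h : BProp n → Prop) : Prop where
  tt : h .tt
  ff : ¬ h .ff
  and : ∀ a b, h (.and a b) ↔ h a ∧ h b
  or : ∀ a b, h (.or a b) ↔ h a ∨ h b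

namespace IsValuation

variable {h : BProp n → Prop}

theorem dnf_iff (hh : IsValuation h) (a : BProp n) : h a ↔ ∃ K ∈ a.dnf, ∀ x ∈ K, h x := by
  induction a with
  | tt => simpa [BProp.dnf] using hh.tt
  | ff => simpa [BProp.dnf] using hh.ff
  | and a b iha ihb =>
    rw [hh.and, iha, ihb]
    simp only [BProp.dnf, Finset.mem_image₂]
    constructor
    · rintro ⟨⟨K, hK, hK'⟩, L, hL, hL'⟩
      exact ⟨_, ⟨K, hK, L, hL, rfl⟩, fun x hx => (Finset.mem_union.1 hx).elim (hK' x) (hL' x)⟩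
    · rintro ⟨_, ⟨K, hK, L, hL, rfl⟩, hx⟩
      exact ⟨⟨K, hK, fun x h => hx x (Finset.mem_union_left _ h)⟩,
        L, hL, fun x h => hx x (Finset.mem_union_right _ h)⟩
  | or a b iha ihb =>
    rw [hh.or, iha, ihb]
    simp only [BProp.dnf, Finset.mem_union, or_and_right, exists_or]
  | _ => simp [BProp.dnf]

theorem conjList (hh : IsValuation h) : ∀ l : List (BProp n), h (conjList l) ↔ ∀ x ∈ l, h x
  | [] => by simpa [ALTLf.conjList] using hh.tt
  | [a] => by simp [ALTLf.conjList]
  | a :: b :: l => by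
    rw [ALTLf.conjList, hh.and, hh.conjList (b :: l)]
    simp

theorem disjList (hh : IsValuation h) : ∀ l : List (BProp n), h (disjList l) ↔ ∃ x ∈ l, h x
  | [] => by simpa [ALTLf.disjList] using hh.ff
  | [a] => by simp [ALTLf.disjList]
  | a :: b :: l => by
    rw [ALTLf.disjList, hh.or, hh.disjList (b :: l)]
    simp

theorem simplify (hh : IsValuation h) (a : BProp n) : h a.simplify ↔ h a := by
  rw [BProp.simplify, hh.disjList, hh.dnf_iff a]
  simp only [List.mem_map, Finset.mem_toList, Finset.mem_filter]
  constructor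
  · rintro ⟨_, ⟨K, ⟨hK, _⟩, rfl⟩, h'⟩
    exact ⟨K, hK, fun x hx => (hh.conjList _).1 h' x (Finset.mem_toList.2 hx)⟩
  · rintro ⟨K, hK, hx⟩
    -- below every conjunction there is a minimal one
    obtain ⟨L, hLK, hL⟩ := (a.dnf : Set (Finset (BProp n))).toFinite.exists_le_minimal
      (Finset.mem_coe.2 hK)
    refine ⟨_, ⟨L, ⟨Finset.mem_coe.1 hL.1, fun M hM hML => ?_⟩, rfl⟩,
      (hh.conjList _).2 fun x hxL => hx x (hLK (Finset.mem_toList.1 hxL))⟩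
    exact le_antisymm hML (hL.2 (Finset.mem_coe.2 hM) hML)

end IsValuation

theorem isValuation_bsat (N : ℕ) (ρ : ℕ → Assign (BVar n)) (i : ℕ) :
    IsValuation fun a => BSat N ρ a i :=
  ⟨trivial, id, fun _ _ => Iff.rfl, fun _ _ => Iff.rfl⟩

/-- The truth value after the end of a sequence, where all atoms count as false. -/
def BProp.AtEnd : BProp n → Prop
  | .tt => True
  | .and a b => a.AtEnd ∧ b.AtEnd
  | .or a b => a.AtEnd ∨ b.AtEnd
  | _ => False

theorem isValuation_atEnd : IsValuation (BProp.AtEnd (n := n)) :=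
  ⟨trivial, id, fun _ _ => Iff.rfl, fun _ _ => Iff.rfl⟩

/-- All atoms of the property belong to `A`. -/
def BProp.Over (A : Set (BProp n)) : BProp n → Prop
  | .tt => True
  | .ff => True
  | .and a b => a.Over A ∧ b.Over A
  | .or a b => a.Over A ∧ b.Over A
  | a => a ∈ A

theorem BProp.Over.of_mem_dnf {A : Set (BProp n)} {a : BProp n} (ha : a.Over A)
    {K : Finset (BProp n)} (hK : K ∈ a.dnf) {x : BProp n} (hx : x ∈ K) : x.Over A ∧ x ∈ A := by
  induction a generalizing K with
  | tt =>
    simp only [BProp.dnf, Finset.mem_singleton] at hK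
    subst hK
    simp at hx
  | ff => simp [BProp.dnf] at hK
  | and a b iha ihb =>
    simp only [BProp.dnf, Finset.mem_image₂] at hK
    obtain ⟨K, hK, L, hL, rfl⟩ := hK
    exact (Finset.mem_union.1 hx).elim (iha ha.1 hK) (ihb ha.2 hL)
  | or a b iha ihb =>
    simp only [BProp.dnf, Finset.mem_union] at hK
    exact hK.elim (fun h => iha ha.1 h hx) (fun h => ihb ha.2 h hx)
  | _ =>
    simp only [BProp.dnf, Finset.mem_singleton] at hK
    subst hK
    rw [Finset.mem_singleton] at hx
    subst hx
    exact ⟨ha, ha⟩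

theorem over_conjList {A : Set (BProp n)} :
    ∀ l : List (BProp n), (∀ x ∈ l, x.Over A) → (conjList l).Over A
  | [], _ => trivial
  | [a], h => h a (by simp)
  | a :: b :: l, h => ⟨h a (by simp), over_conjList (b :: l) fun x hx => h x (by simp [hx])⟩

theorem over_disjList {A : Set (BProp n)} :
    ∀ l : List (BProp n), (∀ x ∈ l, x.Over A) → (disjList l).Over A
  | [], _ => trivial
  | [a], h => h a (by simp)
  | a :: b :: l, h => ⟨h a (by simp), over_disjList (b :: l) fun x hx => h x (by simp [hx])⟩

theorem BProp.Over.simplify {A : Set (BProp n)} {a : BProp n} (ha : a.Over A) :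
    a.simplify.Over A := by
  refine over_disjList _ fun x hx => ?_
  simp only [List.mem_map, Finset.mem_toList, Finset.mem_filter] at hx
  obtain ⟨K, ⟨hK, _⟩, rfl⟩ := hx
  exact over_conjList _ fun y hy => (ha.of_mem_dnf hK (Finset.mem_toList.1 hy)).1

/-- Up to simplification, there are only finitely many properties over a finite set of atoms,
because the result depends on the disjunctive normal form only. -/
theorem finite_simplify {A : Set (BProp n)} (hA : A.Finite) :
    (BProp.simplify '' {a | a.Over A}).Finite := by
  refine Set.Finite.subset ((Finset.finite_toSet hA.toFinset.powerset.powerset).image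
    fun D => disjList ((D.filter fun K => ∀ L ∈ D, L ⊆ K → L = K).toList.map
      fun K => conjList K.toList)) ?_
  rintro _ ⟨a, ha, rfl⟩
  refine ⟨a.dnf, ?_, rfl⟩
  simp only [Finset.mem_coe, Finset.mem_powerset]
  intro K hK
  rw [Finset.mem_powerset]
  exact fun x hx => hA.mem_toFinset.2 (BProp.Over.of_mem_dnf ha hK hx).2

/-- The property is one of the constants `⊤` and `⊥`. -/
def BProp.IsConst (a : BProp n) : Prop := a = .tt ∨ a = .ff

theorem BProp.simplify_of_dnf_empty {a : BProp n} (h : a.dnf = ∅) : a.simplify = .ff := by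
  simp [BProp.simplify, h, disjList]

theorem BProp.simplify_of_dnf_top {a : BProp n} (h : a.dnf = {∅}) : a.simplify = .tt := by
  have : (a.dnf.filter fun K => ∀ L ∈ a.dnf, L ⊆ K → L = K) = {∅} := by
    ext K
    simp only [Finset.mem_filter, h, Finset.mem_singleton]
    constructor
    · exact fun h => h.1
    · rintro rfl
      exact ⟨rfl, fun L hL _ => hL⟩
  rw [BProp.simplify, this]
  simp [disjList, conjList]

theorem BProp.IsConst.and {a b : BProp n} (ha : a.IsConst) (hb : b.IsConst) :
    (BProp.and a b).simplify.IsConst := by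
  rcases ha with rfl | rfl <;> rcases hb with rfl | rfl
  · exact .inl (BProp.simplify_of_dnf_top (by simp [BProp.dnf]))
  all_goals exact .inr (BProp.simplify_of_dnf_empty (by simp [BProp.dnf]))

theorem BProp.IsConst.or {a b : BProp n} (ha : a.IsConst) (hb : b.IsConst) :
    (BProp.or a b).simplify.IsConst := by
  rcases ha with rfl | rfl <;> rcases hb with rfl | rfl
  · exact .inl (BProp.simplify_of_dnf_top (by simp [BProp.dnf]))
  · exact .inl (BProp.simplify_of_dnf_top (by simp [BProp.dnf]))
  · exact .inl (BProp.simplify_of_dnf_top (by simp [BProp.dnf]))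
  · exact .inr (BProp.simplify_of_dnf_empty (by simp [BProp.dnf]))

/-! ### The transition relation on properties -/

/-- Induction over the membership in `δ`. The cases of the temporal operators `G` and `U` reduce
to those of their unfoldings, at which `δ` takes the same value. -/
theorem delta_induction {motive : BProp n → BProp n → LSym n → Prop}
    (tt : motive .tt .tt ⟨∅, false, false⟩) (ff : motive .ff .ff ⟨∅, false, false⟩)
    (con_tt : ∀ c, motive (.con c) .tt ⟨{c}, false, false⟩)
    (con_ff : ∀ c, motive (.con c) .ff ⟨{c.neg}, false, false⟩)
    (ncon_ff : ∀ c, motive (.ncon c) .ff ⟨{c}, false, false⟩)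
    (ncon_tt : ∀ c, motive (.ncon c) .tt ⟨{c.neg}, false, false⟩)
    (and : ∀ a b a' b' (x y : LSym n), motive a a' x → motive b b' y → (x.union y).IsSat →
      motive (.and a b) (BProp.and a' b').simplify (x.union y))
    (or : ∀ a b a' b' (x y : LSym n), motive a a' x → motive b b' y → (x.union y).IsSat →
      motive (.or a b) (BProp.or a' b').simplify (x.union y))
    (snext : ∀ a, motive (.snext a) a ⟨∅, false, true⟩)
    (snext_last : ∀ a, motive (.snext a) .ff ⟨∅, true, false⟩)
    (wnext : ∀ a, motive (.wnext a) a ⟨∅, false, true⟩)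
    (wnext_last : ∀ a, motive (.wnext a) .tt ⟨∅, true, false⟩)
    (glob : ∀ a b x, motive (.and a (.wnext (.glob a))) b x → motive (.glob a) b x)
    (til : ∀ a a' b x, motive (.or a' (.and a (.snext (.til a a')))) b x →
      motive (.til a a') b x) :
    ∀ {a b : BProp n} {x : LSym n}, (b, x) ∈ delta a → motive a b x := by
  have hand : ∀ {a b : BProp n} {R R' : Set (BProp n × LSym n)},
      (∀ {a' x}, (a', x) ∈ R → motive a a' x) → (∀ {b' y}, (b', y) ∈ R' → motive b b' y) →
      ∀ {b' x}, (b', x) ∈ oAnd R R' → motive (.and a b) b' x := by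
    rintro a b R R' h h' b' x ⟨⟨a₁, x₁⟩, h₁, ⟨a₂, x₂⟩, h₂, hsat, heq⟩
    cases heq
    exact and _ _ _ _ _ _ (h h₁) (h' h₂) hsat
  have hor : ∀ {a b : BProp n} {R R' : Set (BProp n × LSym n)},
      (∀ {a' x}, (a', x) ∈ R → motive a a' x) → (∀ {b' y}, (b', y) ∈ R' → motive b b' y) →
      ∀ {b' x}, (b', x) ∈ oOr R R' → motive (.or a b) b' x := by
    rintro a b R R' h h' b' x ⟨⟨a₁, x₁⟩, h₁, ⟨a₂, x₂⟩, h₂, hsat, heq⟩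
    cases heq
    exact or _ _ _ _ _ _ (h h₁) (h' h₂) hsat
  have hsnext : ∀ {a b : BProp n} {x}, (b, x) ∈ deltaSnext a → motive (.snext a) b x := by
    rintro a b x (h | h) <;> cases h
    · exact snext a
    · exact snext_last a
  have hwnext : ∀ {a b : BProp n} {x}, (b, x) ∈ deltaWnext a → motive (.wnext a) b x := by
    rintro a b x (h | h) <;> cases h
    · exact wnext a
    · exact wnext_last a
  intro a
  induction a with
  | tt => intro b x h; cases h; exact tt
  | ff => intro b x h; cases h; exact ff
  | con c =>
    rintro b x (h | h) <;> cases h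
    · exact con_tt c
    · exact con_ff c
  | ncon c =>
    rintro b x (h | h) <;> cases h
    · exact ncon_ff c
    · exact ncon_tt c
  | and a b iha ihb => exact hand iha ihb
  | or a b iha ihb => exact hor iha ihb
  | snext a _ => exact hsnext
  | wnext a _ => exact hwnext
  | glob a ih => exact fun h => glob _ _ _ (hand ih hwnext h)
  | til a b iha ihb => exact fun h => til _ _ _ _ (hor ihb (hand iha hsnext) h)

theorem bsat_glob_iff {N : ℕ} {ρ : ℕ → Assign (BVar n)} {a : BProp n} {i : ℕ} (hi : i < N) :
    BSat N ρ (.glob a) i ↔ BSat N ρ (.and a (.wnext (.glob a))) i := by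
  simp only [BSat]
  constructor
  · exact fun h => ⟨h i le_rfl hi, fun _ j hj hjN => h j (by omega) hjN⟩
  · rintro ⟨h, h'⟩ j hj hjN
    rcases hj.eq_or_lt with rfl | hj
    · exact h
    · exact h' (by omega) j hj hjN

theorem bsat_til_iff {N : ℕ} {ρ : ℕ → Assign (BVar n)} {a b : BProp n} {i : ℕ} (hi : i < N) :
    BSat N ρ (.til a b) i ↔ BSat N ρ (.or b (.and a (.snext (.til a b)))) i := by
  simp only [BSat]
  exact untilAt_iff hi

/-- All constraints of the symbol hold. -/
def LSym.HoldsAt (x : LSym n) (α : Assign (BVar n)) : Prop := ∀ c ∈ x.cs, c.Holds α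

theorem LSym.holdsAt_union {x y : LSym n} {α : Assign (BVar n)} :
    (x.union y).HoldsAt α ↔ x.HoldsAt α ∧ y.HoldsAt α := by
  simp only [LSym.HoldsAt, LSym.union, Finset.mem_union, or_imp, forall_and]

/-- Before the last instant, a transition replaces a property by one that has the same truth value
at the next instant. -/
theorem bsat_iff_of_mem_delta {N : ℕ} {ρ : ℕ → Assign (BVar n)} {i : ℕ} (hi : i + 1 < N)
    {a b : BProp n} {x : LSym n} (h : (b, x) ∈ delta a) (hx : x.HoldsAt (ρ i))
    (hl : x.last = false) : BSat N ρ a i ↔ BSat N ρ b (i + 1) := by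
  revert hx hl
  refine delta_induction (motive := fun a b x => x.HoldsAt (ρ i) → x.last = false →
    (BSat N ρ a i ↔ BSat N ρ b (i + 1))) ?_ ?_ ?_ ?_ ?_ ?_ ?_ ?_ ?_ ?_ ?_ ?_ ?_ ?_ h
  · exact fun _ _ => Iff.rfl
  · exact fun _ _ => Iff.rfl
  · exact fun c hx _ => iff_of_true (hx c (by simp)) trivial
  · exact fun c hx _ => iff_of_false ((c.neg_holds _).1 (hx _ (by simp))) id
  · exact fun c hx _ => iff_of_false (not_not_intro (hx c (by simp))) id
  · exact fun c hx _ => iff_of_true ((c.neg_holds _).1 (hx _ (by simp))) trivial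
  · intro a b a' b' x y iha ihb _ hx hl
    rw [LSym.holdsAt_union] at hx
    simp only [LSym.union, Bool.or_eq_false_iff] at hl
    exact (and_congr (iha hx.1 hl.1) (ihb hx.2 hl.2)).trans
      ((isValuation_bsat N ρ (i + 1)).simplify (.and a' b')).symm
  · intro a b a' b' x y iha ihb _ hx hl
    rw [LSym.holdsAt_union] at hx
    simp only [LSym.union, Bool.or_eq_false_iff] at hl
    exact (or_congr (iha hx.1 hl.1) (ihb hx.2 hl.2)).trans
      ((isValuation_bsat N ρ (i + 1)).simplify (.or a' b')).symm
  · exact fun a _ _ => by simp [BSat, hi]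
  · exact fun a _ hl => by simp at hl
  · exact fun a _ _ => by simp [BSat, hi]
  · exact fun a _ hl => by simp at hl
  · exact fun a b x ih hx hl => (bsat_glob_iff (by omega)).trans (ih hx hl)
  · exact fun a a' b x ih hx hl => (bsat_til_iff (by omega)).trans (ih hx hl)

/-- The temporal operators leave an obligation for the next instant only on symbols with the
marker `¬λ`. -/
theorem isConst_of_mem_delta {a b : BProp n} {x : LSym n} (h : (b, x) ∈ delta a)
    (hl : x.notLast = false) : b.IsConst := by
  revert hl
  refine delta_induction (motive := fun a b x => x.notLast = false → b.IsConst)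
    ?_ ?_ ?_ ?_ ?_ ?_ ?_ ?_ ?_ ?_ ?_ ?_ ?_ ?_ h
  · exact fun _ => .inl rfl
  · exact fun _ => .inr rfl
  · exact fun _ _ => .inl rfl
  · exact fun _ _ => .inr rfl
  · exact fun _ _ => .inr rfl
  · exact fun _ _ => .inl rfl
  · intro a b a' b' x y iha ihb _ hl
    simp only [LSym.union, Bool.or_eq_false_iff] at hl
    exact (iha hl.1).and (ihb hl.2)
  · intro a b a' b' x y iha ihb _ hl
    simp only [LSym.union, Bool.or_eq_false_iff] at hl
    exact (iha hl.1).or (ihb hl.2)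
  · exact fun _ hl => by simp at hl
  · exact fun _ _ => .inr rfl
  · exact fun _ hl => by simp at hl
  · exact fun _ _ => .inl rfl
  · exact fun _ _ _ ih => ih
  · exact fun _ _ _ _ ih => ih

/-- At the last instant, a property that is true is replaced by one that is true after the end,
unless the marker `¬λ` has been guessed wrongly. -/
theorem atEnd_of_mem_delta {ρ : ℕ → Assign (BVar n)} {i : ℕ} {a b : BProp n} {x : LSym n}
    (h : (b, x) ∈ delta a) (hx : x.HoldsAt (ρ i)) (hl : x.notLast = false)
    (hsat : BSat (i + 1) ρ a i) : b.AtEnd := by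
  revert hx hl hsat
  refine delta_induction (motive := fun a b x => x.HoldsAt (ρ i) → x.notLast = false →
    BSat (i + 1) ρ a i → b.AtEnd) ?_ ?_ ?_ ?_ ?_ ?_ ?_ ?_ ?_ ?_ ?_ ?_ ?_ ?_ h
  · exact fun _ _ _ => trivial
  · exact fun _ _ h => h
  · exact fun _ _ _ _ => trivial
  · exact fun c hx _ h => (c.neg_holds _).1 (hx _ (by simp)) h
  · exact fun c hx _ h => h (hx c (by simp))
  · exact fun c _ _ _ => trivial
  · intro a b a' b' x y iha ihb _ hx hl h
    rw [LSym.holdsAt_union] at hx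
    simp only [LSym.union, Bool.or_eq_false_iff] at hl
    exact (isValuation_atEnd.simplify _).2 ⟨iha hx.1 hl.1 h.1, ihb hx.2 hl.2 h.2⟩
  · intro a b a' b' x y iha ihb _ hx hl h
    rw [LSym.holdsAt_union] at hx
    simp only [LSym.union, Bool.or_eq_false_iff] at hl
    exact (isValuation_atEnd.simplify _).2 (h.imp (iha hx.1 hl.1) (ihb hx.2 hl.2))
  · exact fun a _ hl => by simp at hl
  · exact fun a _ _ h => absurd h.1 (lt_irrefl _)
  · exact fun a _ hl => by simp at hl
  · exact fun a _ _ _ => trivial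
  · exact fun a b x ih hx hl h => ih hx hl ((bsat_glob_iff (by omega)).1 h)
  · exact fun a a' b x ih hx hl h => ih hx hl ((bsat_til_iff (by omega)).1 h)

/-- The set of atoms is closed under unfolding. -/
structure IsUnfoldingClosed (A : Set (BProp n)) : Prop where
  snext : ∀ a, .snext a ∈ A → a.Over A
  wnext : ∀ a, .wnext a ∈ A → a.Over A
  glob : ∀ a, .glob a ∈ A → a.Over A ∧ .wnext (.glob a) ∈ A
  til : ∀ a b, .til a b ∈ A → a.Over A ∧ b.Over A ∧ .snext (.til a b) ∈ A

/-- At the last instant, a property that has become true is true, even if the marker `¬λ` has been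
guessed wrongly, provided that strong next is never applied to a property that is true after the
end. -/
theorem bsat_of_atEnd {A : Set (BProp n)} (hA : IsUnfoldingClosed A)
    (hA' : ∀ a, .snext a ∈ A → ¬ a.AtEnd) {ρ : ℕ → Assign (BVar n)} {i : ℕ} {a b : BProp n}
    {x : LSym n} (h : (b, x) ∈ delta a) (ha : a.Over A) (hx : x.HoldsAt (ρ i)) (hb : b.AtEnd) :
    BSat (i + 1) ρ a i := by
  revert ha hx hb
  refine delta_induction (motive := fun a b x => a.Over A → x.HoldsAt (ρ i) → b.AtEnd →
    BSat (i + 1) ρ a i) ?_ ?_ ?_ ?_ ?_ ?_ ?_ ?_ ?_ ?_ ?_ ?_ ?_ ?_ h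
  · exact fun _ _ _ => trivial
  · exact fun _ _ h => h
  · exact fun c _ hx _ => hx c (by simp)
  · exact fun c _ _ h => h.elim
  · exact fun c _ _ h => h.elim
  · exact fun c _ hx _ => (c.neg_holds _).1 (hx _ (by simp))
  · intro a b a' b' x y iha ihb _ ha hx hb
    rw [LSym.holdsAt_union] at hx
    have hb := (isValuation_atEnd.simplify _).1 hb
    exact ⟨iha ha.1 hx.1 hb.1, ihb ha.2 hx.2 hb.2⟩
  · intro a b a' b' x y iha ihb _ ha hx hb
    rw [LSym.holdsAt_union] at hx
    exact ((isValuation_atEnd.simplify _).1 hb).imp (iha ha.1 hx.1) (ihb ha.2 hx.2)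
  · exact fun a ha _ hb => (hA' a ha hb).elim
  · exact fun a _ _ hb => hb.elim
  · exact fun a _ _ _ h => absurd h (lt_irrefl _)
  · exact fun a _ _ _ h => absurd h (lt_irrefl _)
  · exact fun a b x ih ha hx hb => (bsat_glob_iff (by omega)).2 (ih (hA.glob a ha) hx hb)
  · exact fun a a' b x ih ha hx hb => (bsat_til_iff (by omega)).2
      (ih ⟨(hA.til a a' ha).2.1, (hA.til a a' ha).1, (hA.til a a' ha).2.2⟩ hx hb)

/-- The successors of a property over `A` are over `A`, and there are only finitely many
candidates for them. -/
theorem over_of_mem_delta {A : Set (BProp n)} (hA : IsUnfoldingClosed A) {a b : BProp n}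
    {x : LSym n} (h : (b, x) ∈ delta a) (ha : a.Over A) :
    b.Over A ∧ (b.IsConst ∨ b ∈ BProp.simplify '' {a | a.Over A} ∨
      .snext b ∈ A ∨ .wnext b ∈ A) := by
  revert ha
  refine delta_induction (motive := fun a b x => a.Over A → b.Over A ∧ (b.IsConst ∨
    b ∈ BProp.simplify '' {a | a.Over A} ∨ .snext b ∈ A ∨ .wnext b ∈ A))
    ?_ ?_ ?_ ?_ ?_ ?_ ?_ ?_ ?_ ?_ ?_ ?_ ?_ ?_ h
  · exact fun _ => ⟨trivial, .inl (.inl rfl)⟩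
  · exact fun _ => ⟨trivial, .inl (.inr rfl)⟩
  · exact fun _ _ => ⟨trivial, .inl (.inl rfl)⟩
  · exact fun _ _ => ⟨trivial, .inl (.inr rfl)⟩
  · exact fun _ _ => ⟨trivial, .inl (.inr rfl)⟩
  · exact fun _ _ => ⟨trivial, .inl (.inl rfl)⟩
  · intro a b a' b' x y iha ihb _ ha
    have : (BProp.and a' b').Over A := ⟨(iha ha.1).1, (ihb ha.2).1⟩
    exact ⟨this.simplify, .inr (.inl ⟨_, this, rfl⟩)⟩
  · intro a b a' b' x y iha ihb _ ha
    have : (BProp.or a' b').Over A := ⟨(iha ha.1).1, (ihb ha.2).1⟩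
    exact ⟨this.simplify, .inr (.inl ⟨_, this, rfl⟩)⟩
  · exact fun a ha => ⟨hA.snext a ha, .inr (.inr (.inl ha))⟩
  · exact fun _ _ => ⟨trivial, .inl (.inr rfl)⟩
  · exact fun a ha => ⟨hA.wnext a ha, .inr (.inr (.inr ha))⟩
  · exact fun _ _ => ⟨trivial, .inl (.inl rfl)⟩
  · exact fun a b x ih ha => ih (hA.glob a ha)
  · exact fun a a' b x ih ha =>
      ih ⟨(hA.til a a' ha).2.1, (hA.til a a' ha).1, (hA.til a a' ha).2.2⟩

/-- All constraints of the property that are not in the scope of a next operator satisfy `p`. -/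
def BProp.Reads (p : Cstr (BVar n) → Prop) : BProp n → Prop
  | .con c => p c
  | .ncon c => p c
  | .and a b => a.Reads p ∧ b.Reads p
  | .or a b => a.Reads p ∧ b.Reads p
  | .glob a => a.Reads p
  | .til a b => a.Reads p ∧ b.Reads p
  | _ => True

theorem cs_subset_of_mem_delta {C : Sym n} {a b : BProp n} {x : LSym n}
    (h : (b, x) ∈ delta a) (ha : a.Reads (· ∈ C)) : x.cs ⊆ C ∪ C.image Cstr.neg := by
  revert ha
  refine delta_induction (motive := fun a b x => a.Reads (· ∈ C) → x.cs ⊆ C ∪ C.image Cstr.neg)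
    ?_ ?_ ?_ ?_ ?_ ?_ ?_ ?_ ?_ ?_ ?_ ?_ ?_ ?_ h
  · exact fun _ => by simp
  · exact fun _ => by simp
  · exact fun c hc => Finset.subset_union_left.trans' (Finset.singleton_subset_iff.2 hc)
  · exact fun c hc => by simpa using Or.inr ⟨c, hc, rfl⟩
  · exact fun c hc => Finset.subset_union_left.trans' (Finset.singleton_subset_iff.2 hc)
  · exact fun c hc => by simpa using Or.inr ⟨c, hc, rfl⟩
  · exact fun a b a' b' x y iha ihb _ ha => Finset.union_subset (iha ha.1) (ihb ha.2)
  · exact fun a b a' b' x y iha ihb _ ha => Finset.union_subset (iha ha.1) (ihb ha.2)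
  · exact fun _ _ => by simp
  · exact fun _ _ => by simp
  · exact fun _ _ => by simp
  · exact fun _ _ => by simp
  · exact fun a b x ih ha => ih ⟨ha, trivial⟩
  · exact fun a a' b x ih ha => ih ⟨ha.2, ha.1, trivial⟩

/-- For given values of the variables, there is a transition whose label holds, and the markers
`λ` and `¬λ` can be chosen as required. -/
theorem exists_mem_delta (α : Assign (BVar n)) (l : Bool) (a : BProp n) :
    ∃ b x, (b, x) ∈ delta a ∧ x.HoldsAt α ∧ (bif l then x.notLast else x.last) = false := by
  have union : ∀ x y : LSym n,
      x.HoldsAt α ∧ (bif l then x.notLast else x.last) = false →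
      y.HoldsAt α ∧ (bif l then y.notLast else y.last) = false →
      (x.union y).IsSat ∧ (x.union y).HoldsAt α ∧
        (bif l then (x.union y).notLast else (x.union y).last) = false := by
    intro x y hx hy
    have h := LSym.holdsAt_union.2 ⟨hx.1, hy.1⟩
    have h' : (bif l then (x.union y).notLast else (x.union y).last) = false := by
      cases l <;> simp only [LSym.union, cond_true, cond_false, Bool.or_eq_false_iff] at hx hy ⊢
      · exact ⟨hx.2, hy.2⟩
      · exact ⟨hx.2, hy.2⟩
    refine ⟨⟨?_, α, h⟩, h, h'⟩
    rintro ⟨h₁, h₂⟩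
    cases l <;> simp_all
  have hand : ∀ {R R' : Set (BProp n × LSym n)},
      (∃ b x, (b, x) ∈ R ∧ x.HoldsAt α ∧ (bif l then x.notLast else x.last) = false) →
      (∃ b x, (b, x) ∈ R' ∧ x.HoldsAt α ∧ (bif l then x.notLast else x.last) = false) →
      ∃ b x, (b, x) ∈ oAnd R R' ∧ x.HoldsAt α ∧ (bif l then x.notLast else x.last) = false := by
    rintro R R' ⟨b, x, h, hx⟩ ⟨b', x', h', hx'⟩
    obtain ⟨hs, hu⟩ := union _ _ hx hx'
    exact ⟨_, _, ⟨(b, x), h, (b', x'), h', hs, rfl⟩, hu⟩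
  have hor : ∀ {R R' : Set (BProp n × LSym n)},
      (∃ b x, (b, x) ∈ R ∧ x.HoldsAt α ∧ (bif l then x.notLast else x.last) = false) →
      (∃ b x, (b, x) ∈ R' ∧ x.HoldsAt α ∧ (bif l then x.notLast else x.last) = false) →
      ∃ b x, (b, x) ∈ oOr R R' ∧ x.HoldsAt α ∧ (bif l then x.notLast else x.last) = false := by
    rintro R R' ⟨b, x, h, hx⟩ ⟨b', x', h', hx'⟩
    obtain ⟨hs, hu⟩ := union _ _ hx hx'
    exact ⟨_, _, ⟨(b, x), h, (b', x'), h', hs, rfl⟩, hu⟩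
  have hsnext : ∀ a : BProp n, ∃ b x, (b, x) ∈ deltaSnext a ∧ x.HoldsAt α ∧
      (bif l then x.notLast else x.last) = false := fun a => by
    cases l
    · exact ⟨_, _, .inl rfl, by simp [LSym.HoldsAt], rfl⟩
    · exact ⟨_, _, .inr rfl, by simp [LSym.HoldsAt], rfl⟩
  have hwnext : ∀ a : BProp n, ∃ b x, (b, x) ∈ deltaWnext a ∧ x.HoldsAt α ∧
      (bif l then x.notLast else x.last) = false := fun a => by
    cases l
    · exact ⟨_, _, .inl rfl, by simp [LSym.HoldsAt], rfl⟩
    · exact ⟨_, _, .inr rfl, by simp [LSym.HoldsAt], rfl⟩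
  have hfalse : (bif l then false else false) = false := by cases l <;> rfl
  induction a with
  | tt => exact ⟨_, _, rfl, by simp [LSym.HoldsAt], hfalse⟩
  | ff => exact ⟨_, _, rfl, by simp [LSym.HoldsAt], hfalse⟩
  | con c =>
    by_cases hc : c.Holds α
    · exact ⟨_, _, .inl rfl, by simpa [LSym.HoldsAt] using hc, hfalse⟩
    · exact ⟨_, _, .inr rfl, by simpa [LSym.HoldsAt, Cstr.neg_holds] using hc, hfalse⟩
  | ncon c =>
    by_cases hc : c.Holds α
    · exact ⟨_, _, .inl rfl, by simpa [LSym.HoldsAt] using hc, hfalse⟩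
    · exact ⟨_, _, .inr rfl, by simpa [LSym.HoldsAt, Cstr.neg_holds] using hc, hfalse⟩
  | and a b iha ihb => exact hand iha ihb
  | or a b iha ihb => exact hor iha ihb
  | snext a _ => exact hsnext a
  | wnext a _ => exact hwnext a
  | glob a ih => exact hand ih (hwnext _)
  | til a b iha ihb => exact hor ihb (hand iha (hsnext _))

/-! ### Reachable properties -/

/-- The subproperties of a property, together with the unfoldings of temporal operators. -/
def BProp.closure : BProp n → Set (BProp n)
  | .tt => {.tt}
  | .ff => {.ff}
  | .con c => {.con c}
  | .ncon c => {.ncon c}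
  | .and a b => insert (.and a b) (a.closure ∪ b.closure)
  | .or a b => insert (.or a b) (a.closure ∪ b.closure)
  | .snext a => insert (.snext a) a.closure
  | .wnext a => insert (.wnext a) a.closure
  | .glob a => insert (.glob a) (insert (.wnext (.glob a)) a.closure)
  | .til a b => insert (.til a b) (insert (.snext (.til a b)) (a.closure ∪ b.closure))

theorem BProp.self_mem_closure (a : BProp n) : a ∈ a.closure := by
  cases a <;> simp [BProp.closure]

theorem BProp.finite_closure (a : BProp n) : a.closure.Finite := by
  induction a with
  | and a b iha ihb => exact (iha.union ihb).insert _
  | or a b iha ihb => exact (iha.union ihb).insert _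
  | snext a ih => exact ih.insert _
  | wnext a ih => exact ih.insert _
  | glob a ih => exact (ih.insert _).insert _
  | til a b iha ihb => exact ((iha.union ihb).insert _).insert _
  | _ => exact Set.finite_singleton _

theorem BProp.closure_subset {a b : BProp n} (h : b ∈ a.closure) : b.closure ⊆ a.closure := by
  induction a with
  | and a₁ a₂ ih₁ ih₂ =>
    rcases h with rfl | h | h
    · exact subset_rfl
    · exact ((ih₁ h).trans Set.subset_union_left).trans (Set.subset_insert _ _)
    · exact ((ih₂ h).trans Set.subset_union_right).trans (Set.subset_insert _ _)
  | or a₁ a₂ ih₁ ih₂ =>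
    rcases h with rfl | h | h
    · exact subset_rfl
    · exact ((ih₁ h).trans Set.subset_union_left).trans (Set.subset_insert _ _)
    · exact ((ih₂ h).trans Set.subset_union_right).trans (Set.subset_insert _ _)
  | snext a ih =>
    rcases h with rfl | h
    · exact subset_rfl
    · exact (ih h).trans (Set.subset_insert _ _)
  | wnext a ih =>
    rcases h with rfl | h
    · exact subset_rfl
    · exact (ih h).trans (Set.subset_insert _ _)
  | glob a ih =>
    rcases h with rfl | rfl | h
    · exact subset_rfl
    · exact Set.insert_subset (by simp [BProp.closure]) subset_rfl
    · exact ((ih h).trans (Set.subset_insert _ _)).trans (Set.subset_insert _ _)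
  | til a₁ a₂ ih₁ ih₂ =>
    rcases h with rfl | rfl | h | h
    · exact subset_rfl
    · exact Set.insert_subset (by simp [BProp.closure]) subset_rfl
    · exact (((ih₁ h).trans Set.subset_union_left).trans (Set.subset_insert _ _)).trans
        (Set.subset_insert _ _)
    · exact (((ih₂ h).trans Set.subset_union_right).trans (Set.subset_insert _ _)).trans
        (Set.subset_insert _ _)
  | _ => cases h; exact subset_rfl

theorem BProp.over_of_closure_subset {A : Set (BProp n)} {a : BProp n} (h : a.closure ⊆ A) :
    a.Over A := by
  induction a with
  | tt => trivial
  | ff => trivial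
  | and a b iha ihb =>
    exact ⟨iha fun x hx => h (.inr (.inl hx)), ihb fun x hx => h (.inr (.inr hx))⟩
  | or a b iha ihb =>
    exact ⟨iha fun x hx => h (.inr (.inl hx)), ihb fun x hx => h (.inr (.inr hx))⟩
  | _ => exact h (BProp.self_mem_closure _)

theorem BProp.over_of_mem_closure {a b : BProp n} (h : b ∈ a.closure) : b.Over a.closure :=
  BProp.over_of_closure_subset (BProp.closure_subset h)

theorem BProp.isUnfoldingClosed_closure (a : BProp n) : IsUnfoldingClosed a.closure where
  snext b h := BProp.over_of_mem_closure
    (BProp.closure_subset h (.inr b.self_mem_closure))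
  wnext b h := BProp.over_of_mem_closure
    (BProp.closure_subset h (.inr b.self_mem_closure))
  glob b h := ⟨BProp.over_of_mem_closure
    (BProp.closure_subset h (.inr (.inr b.self_mem_closure))),
    BProp.closure_subset h (.inr (.inl rfl))⟩
  til b c h := ⟨BProp.over_of_mem_closure
    (BProp.closure_subset h (.inr (.inr (.inl b.self_mem_closure)))),
    BProp.over_of_mem_closure
      (BProp.closure_subset h (.inr (.inr (.inr c.self_mem_closure)))),
    BProp.closure_subset h (.inr (.inl rfl))⟩

theorem NReach.over {q₀ : BProp n} {q : NState n} (h : NReach q₀ q) :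
    ∀ {b}, q = .quot b → b.Over q₀.closure := by
  induction h with
  | init => rintro _ ⟨⟩; exact BProp.over_of_mem_closure q₀.self_mem_closure
  | top => rintro _ ⟨⟩; trivial
  | qplus => rintro _ ⟨⟩
  | qminus => rintro _ ⟨⟩
  | step _ hd ih =>
    rintro _ ⟨⟩
    exact (over_of_mem_delta q₀.isUnfoldingClosed_closure hd (ih rfl)).1

theorem finite_nreach (q₀ : BProp n) : {q | NReach q₀ q}.Finite := by
  have hfin : ({.tt, .ff, q₀} ∪ BProp.simplify '' {a | a.Over q₀.closure} ∪
      BProp.snext ⁻¹' q₀.closure ∪ BProp.wnext ⁻¹' q₀.closure).Finite :=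
    (((Set.toFinite _).union (finite_simplify q₀.finite_closure)).union
      (q₀.finite_closure.preimage (Function.Injective.injOn fun _ _ h => by cases h; rfl))).union
      (q₀.finite_closure.preimage (Function.Injective.injOn fun _ _ h => by cases h; rfl))
  refine ((hfin.image NState.quot).union (Set.toFinite {.qplus, .qminus})).subset ?_
  intro q hq
  induction hq with
  | init => exact .inl ⟨_, .inl (.inl (.inl (by simp))), rfl⟩
  | top => exact .inl ⟨_, .inl (.inl (.inl (by simp))), rfl⟩
  | qplus => exact .inr (by simp)
  | qminus => exact .inr (by simp)
  | step hr hd _ =>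
    refine .inl ⟨_, ?_, rfl⟩
    rcases (over_of_mem_delta q₀.isUnfoldingClosed_closure hd (hr.over rfl)).2 with
      (rfl | rfl) | h | h | h
    · exact .inl (.inl (.inl (by simp)))
    · exact .inl (.inl (.inl (by simp)))
    · exact .inl (.inl (.inr h))
    · exact .inl (.inr h)
    · exact .inr h

theorem BProp.cstrs_subset_of_mem_closure {a b : BProp n} (h : b ∈ a.closure) :
    b.cstrs ⊆ a.cstrs := by
  induction a with
  | and a₁ a₂ ih₁ ih₂ =>
    rcases h with rfl | h | h
    · exact subset_rfl
    · exact (ih₁ h).trans Finset.subset_union_left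
    · exact (ih₂ h).trans Finset.subset_union_right
  | or a₁ a₂ ih₁ ih₂ =>
    rcases h with rfl | h | h
    · exact subset_rfl
    · exact (ih₁ h).trans Finset.subset_union_left
    · exact (ih₂ h).trans Finset.subset_union_right
  | snext a ih =>
    rcases h with rfl | h
    · exact subset_rfl
    · exact ih h
  | wnext a ih =>
    rcases h with rfl | h
    · exact subset_rfl
    · exact ih h
  | glob a ih =>
    rcases h with rfl | rfl | h
    · exact subset_rfl
    · exact subset_rfl
    · exact ih h
  | til a₁ a₂ ih₁ ih₂ =>
    rcases h with rfl | rfl | h | h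
    · exact subset_rfl
    · exact subset_rfl
    · exact (ih₁ h).trans Finset.subset_union_left
    · exact (ih₂ h).trans Finset.subset_union_right
  | _ => cases h; exact subset_rfl

theorem BProp.reads_of_cstrs_subset {C : Sym n} {a : BProp n} (h : a.cstrs ⊆ C) :
    a.Reads (· ∈ C) := by
  induction a with
  | con c => exact h (Finset.mem_singleton_self c)
  | ncon c => exact h (Finset.mem_singleton_self c)
  | and a b iha ihb => exact ⟨iha (Finset.union_subset_left h), ihb (Finset.union_subset_right h)⟩
  | or a b iha ihb => exact ⟨iha (Finset.union_subset_left h), ihb (Finset.union_subset_right h)⟩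
  | glob a ih => exact ih h
  | til a b iha ihb => exact ⟨iha (Finset.union_subset_left h), ihb (Finset.union_subset_right h)⟩
  | _ => trivial

theorem BProp.Over.reads {A : Set (BProp n)} {p : Cstr (BVar n) → Prop} {a : BProp n}
    (ha : a.Over A) (hA : ∀ b ∈ A, b.Reads p) : a.Reads p := by
  induction a with
  | tt => trivial
  | ff => trivial
  | and a b iha ihb => exact ⟨iha ha.1, ihb ha.2⟩
  | or a b iha ihb => exact ⟨iha ha.1, ihb ha.2⟩
  | _ => exact hA _ ha

theorem NReach.reads {q₀ b : BProp n} (h : NReach q₀ (.quot b)) : b.Reads (· ∈ q₀.cstrs) :=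
  (h.over rfl).reads fun _ hx => BProp.reads_of_cstrs_subset (BProp.cstrs_subset_of_mem_closure hx)

theorem BProp.Reads.and {p q : Cstr (BVar n) → Prop} {a : BProp n} (hp : a.Reads p)
    (hq : a.Reads q) : a.Reads fun c => p c ∧ q c := by
  induction a with
  | con c => exact ⟨hp, hq⟩
  | ncon c => exact ⟨hp, hq⟩
  | and a b iha ihb => exact ⟨iha hp.1 hq.1, ihb hp.2 hq.2⟩
  | or a b iha ihb => exact ⟨iha hp.1 hq.1, ihb hp.2 hq.2⟩
  | glob a ih => exact ih hp hq
  | til a b iha ihb => exact ⟨iha hp.1 hq.1, ihb hp.2 hq.2⟩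
  | _ => trivial

theorem Expr.not_mentions {X : Srt → Type} {s : Srt} {e : Expr X s} {p : (s : Srt) → X s → Prop}
    (h : ∀ s x, ¬ p s x) : ¬ e.Mentions p := by
  induction e with
  | var x => exact h _ x
  | const k => exact id
  | add a b iha ihb => exact not_or.2 ⟨iha, ihb⟩
  | smul k a ih => exact ih

theorem Cstr.not_mentions {X : Srt → Type} {c : Cstr X} {p : (s : Srt) → X s → Prop}
    (h : ∀ s x, ¬ p s x) : ¬ c.Mentions p := by
  cases c <;> exact not_or.2 ⟨Expr.not_mentions h, Expr.not_mentions h⟩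

/-- Lookback constraints occur in the translation of a property only in the scope of a next
operator. -/
theorem reads_back (β : Bool) (ψ : Property n) :
    (back β ψ).Reads fun c => ¬ c.Mentions fun _ x => x.1 = .pre := by
  have hcur : ∀ c : Cstr (LVar n), ¬ (toCur c).Mentions fun _ x => x.1 = .pre := fun c h => by
    rw [toCur, Cstr.mentions_map] at h
    exact Cstr.not_mentions (fun _ _ => Time.noConfusion) h
  induction ψ generalizing β with
  | con c =>
    cases β <;> simp only [back] <;> split_ifs
    · trivial
    · exact hcur c
    · trivial
    · exact hcur c
  | and a b iha ihb => cases β <;> exact ⟨iha _, ihb _⟩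
  | not a ih => cases β <;> exact ih _
  | next a ih => cases β <;> trivial
  | til a b iha ihb =>
    cases β
    · exact ⟨ihb _, ihb _, iha _, ihb _⟩
    · exact ⟨iha _, ihb _⟩

/-- The property does not contain `⊤` or `⊥`. -/
def BProp.NoConst : BProp n → Prop
  | .tt => False
  | .ff => False
  | .con _ => True
  | .ncon _ => True
  | .and a b => a.NoConst ∧ b.NoConst
  | .or a b => a.NoConst ∧ b.NoConst
  | .snext a => a.NoConst
  | .wnext a => a.NoConst
  | .glob a => a.NoConst
  | .til a b => a.NoConst ∧ b.NoConst

theorem BProp.NoConst.not_atEnd {a : BProp n} (ha : a.NoConst) : ¬ a.AtEnd := by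
  induction a with
  | tt => exact ha.elim
  | and a b iha _ => exact fun h => iha ha.1 h.1
  | or a b iha ihb => exact fun h => h.elim (iha ha.1) (ihb ha.2)
  | _ => exact id

theorem BProp.NoConst.of_mem_closure {a b : BProp n} (ha : a.NoConst) (h : b ∈ a.closure) :
    b.NoConst := by
  induction a with
  | and a₁ a₂ ih₁ ih₂ =>
    rcases h with rfl | h | h
    exacts [ha, ih₁ ha.1 h, ih₂ ha.2 h]
  | or a₁ a₂ ih₁ ih₂ =>
    rcases h with rfl | h | h
    exacts [ha, ih₁ ha.1 h, ih₂ ha.2 h]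
  | snext a ih =>
    rcases h with rfl | h
    exacts [ha, ih ha h]
  | wnext a ih =>
    rcases h with rfl | h
    exacts [ha, ih ha h]
  | glob a ih =>
    rcases h with rfl | rfl | h
    exacts [ha, ha, ih ha h]
  | til a₁ a₂ ih₁ ih₂ =>
    rcases h with rfl | rfl | h | h
    exacts [ha, ha, ih₁ ha.1 h, ih₂ ha.2 h]
  | _ => cases h; exact ha

theorem noConst_back (β : Bool) (ψ : Property n) : (back β ψ).NoConst := by
  induction ψ generalizing β with
  | con c => cases β <;> simp only [back] <;> split_ifs <;> trivial
  | and a b iha ihb => cases β <;> exact ⟨iha _, ihb _⟩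
  | not a ih => cases β <;> exact ih _
  | next a ih => cases β <;> exact ih _
  | til a b iha ihb =>
    cases β
    · exact ⟨ihb _, ihb _, iha _, ihb _⟩
    · exact ⟨iha _, ihb _⟩

/-! ### Runs of the deterministic automaton -/

/-- The assignment to `V_pre` and `V_cur` given by two assignments to `V`. -/
def pairAssign (α β : Assign (Var n)) : Assign (BVar n) := fun s x =>
  match x.1 with
  | .pre => α s x.2
  | .cur => β s x.2

/-- The constraints over `C` and their complements that hold. -/
def satSym (C : Sym n) (α : Assign (BVar n)) : Sym n :=
  (C ∪ C.image Cstr.neg).filter fun c => c.Holds α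

theorem mem_satSym {C : Sym n} {α : Assign (BVar n)} {c : Cstr (BVar n)} :
    c ∈ satSym C α ↔ c ∈ C ∪ C.image Cstr.neg ∧ c.Holds α := by
  rw [satSym, Finset.mem_filter]

theorem satSym_mem_maxSat (C : Sym n) (α : Assign (BVar n)) : satSym C α ∈ maxSat C := by
  refine ⟨⟨Finset.filter_subset _ _, α, fun c hc => (mem_satSym.1 hc).2⟩, ?_⟩
  rintro ς ⟨hς, β, hβ⟩ hle c hc
  refine mem_satSym.2 ⟨hς hc, ?_⟩
  by_contra hcα
  rcases Finset.mem_union.1 (hς hc) with hcC | hcC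
  · have : c.neg ∈ satSym C α := mem_satSym.2
      ⟨Finset.mem_union_right _ (Finset.mem_image_of_mem _ hcC), (c.neg_holds α).2 hcα⟩
    exact (c.neg_holds β).1 (hβ _ (hle this)) (hβ _ hc)
  · obtain ⟨d, hd, rfl⟩ := Finset.mem_image.1 hcC
    have : d ∈ satSym C α := mem_satSym.2
      ⟨Finset.mem_union_left _ hd, by_contra fun h => hcα ((d.neg_holds α).2 h)⟩
    exact (d.neg_holds β).1 (hβ _ hc) (hβ _ (hle this))

theorem eq_satSym {C ς : Sym n} {α : Assign (BVar n)} (h : ς ∈ maxSat C)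
    (hα : ∀ c ∈ ς, c.Holds α) : ς = satSym C α := by
  have hle : ς ≤ satSym C α := fun c hc => mem_satSym.2 ⟨h.1.1 hc, hα c hc⟩
  exact le_antisymm hle (h.2 (satSym_mem_maxSat C α).1 hle)

/-- The constraints that are evaluated in a state of the automaton. -/
def dfaCstrs (ψ : Property n) (P : DState n) : Sym n :=
  if P = {.quot (back true ψ)} then curPart (back true ψ).cstrs else (back true ψ).cstrs

/-- The successor of a state for given previous and current values of the variables. -/
def dfaStep (ψ : Property n) (P : DState n) (α β : Assign (Var n)) : DState n :=
  {q' | ∃ q ∈ P, ∃ x : Sym n, NTrans (back true ψ) q x q' ∧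
    x ⊆ satSym (dfaCstrs ψ P) (pairAssign α β)}

theorem dfa_trans_iff {ψ : Property n} {P P' : DState n} {ς : Sym n} :
    (dfa ψ).trans P ς P' ↔ P ∈ (dfa ψ).states ∧ ς ∈ maxSat (dfaCstrs ψ P) ∧
      P' = {q' | ∃ q ∈ P, ∃ x : Sym n, NTrans (back true ψ) q x q' ∧ x ⊆ ς} := by
  simp only [dfa, dfaCstrs, Set.mem_ofPred_eq]
  by_cases h : P = {.quot (back true ψ)} <;> simp [h]

theorem dfa_trans_and_holds_iff {ψ : Property n} {P P' : DState n} {ς : Sym n}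
    {α β : Assign (Var n)} :
    ((dfa ψ).trans P ς P' ∧ ∀ c ∈ ς, c.Holds (pairAssign α β)) ↔
      P ∈ (dfa ψ).states ∧ ς = satSym (dfaCstrs ψ P) (pairAssign α β) ∧ P' = dfaStep ψ P α β := by
  rw [dfa_trans_iff]
  constructor
  · rintro ⟨⟨hP, hς, rfl⟩, h⟩
    obtain rfl := eq_satSym hς h
    exact ⟨hP, rfl, rfl⟩
  · rintro ⟨hP, rfl, rfl⟩
    exact ⟨⟨hP, satSym_mem_maxSat _ _, rfl⟩, fun c hc => (mem_satSym.1 hc).2⟩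

theorem NTrans.reach {q₀ : BProp n} {q q' : NState n} {x : Sym n} (h : NTrans q₀ q x q') :
    NReach q₀ q' := by
  cases h with
  | inner hr hd _ => exact hr.step hd
  | acc _ _ _ => exact .qplus
  | rej _ _ _ => exact .qminus

theorem dfaStep_mem_states (ψ : Property n) (P : DState n) (α β : Assign (Var n)) :
    dfaStep ψ P α β ∈ (dfa ψ).states := by
  rintro q' ⟨q, _, x, h, _⟩
  exact h.reach

theorem start_mem_states (ψ : Property n) : (dfa ψ).start ∈ (dfa ψ).states := by
  rintro q rfl
  exact .init

theorem finite_states (ψ : Property n) : (dfa ψ).states.Finite :=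
  (finite_nreach (back true ψ)).finite_subsets

/-- The labels of the transitions that are possible in a state are built from the constraints that
are evaluated there. -/
theorem cs_subset_satSym {ψ : Property n} {P : DState n} (hP : P ∈ (dfa ψ).states)
    {α β : Assign (Var n)} {a b : BProp n} (ha : .quot a ∈ P) {x : LSym n}
    (h : (b, x) ∈ delta a) (hx : x.HoldsAt (pairAssign α β)) :
    x.cs ⊆ satSym (dfaCstrs ψ P) (pairAssign α β) := by
  have hreads : a.Reads (· ∈ dfaCstrs ψ P) := by
    by_cases hP' : P = {.quot (back true ψ)}
    · have : a = back true ψ := by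
        subst hP'
        cases ha
        rfl
      subst this
      simp only [dfaCstrs, if_pos hP', curPart, Finset.mem_filter]
      exact (BProp.reads_of_cstrs_subset subset_rfl).and (reads_back true ψ)
    · simp only [dfaCstrs, if_neg hP']
      exact (hP _ ha).reads
  exact fun c hc => mem_satSym.2 ⟨cs_subset_of_mem_delta h hreads hc, hx c hc⟩

theorem quot_mem_dfaStep_iff {ψ : Property n} {P : DState n} (hP : P ∈ (dfa ψ).states)
    {α β : Assign (Var n)} {b : BProp n} :
    .quot b ∈ dfaStep ψ P α β ↔ ∃ a x, .quot a ∈ P ∧ (b, x) ∈ delta a ∧ x.last = false ∧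
      x.HoldsAt (pairAssign α β) := by
  constructor
  · rintro ⟨q, hq, x, ⟨hr, hd, hl⟩, hx⟩
    exact ⟨_, _, hq, hd, hl, fun c hc => (mem_satSym.1 (hx hc)).2⟩
  · rintro ⟨a, x, ha, hd, hl, hx⟩
    exact ⟨_, ha, _, .inner (hP _ ha) hd hl, cs_subset_satSym hP ha hd hx⟩

theorem qplus_mem_dfaStep_iff {ψ : Property n} {P : DState n} (hP : P ∈ (dfa ψ).states)
    {α β : Assign (Var n)} :
    .qplus ∈ dfaStep ψ P α β ↔ ∃ a x, .quot a ∈ P ∧ (.tt, x) ∈ delta a ∧ x.last = true ∧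
      x.HoldsAt (pairAssign α β) := by
  constructor
  · rintro ⟨q, hq, x, h, hx⟩
    cases h with
    | acc hr hd hl => exact ⟨_, _, hq, hd, hl, fun c hc => (mem_satSym.1 (hx hc)).2⟩
  · rintro ⟨a, x, ha, hd, hl, hx⟩
    exact ⟨_, ha, _, .acc (hP _ ha) hd hl, cs_subset_satSym hP ha hd hx⟩

/-- The state and the last assignment after a sequence of assignments has been read. -/
def run (ψ : Property n) (p : DState n × Assign (Var n)) (τ : Seq n) :
    DState n × Assign (Var n) :=
  τ.foldl (fun p β => (dfaStep ψ p.1 p.2 β, β)) p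

theorem run_append (ψ : Property n) (p : DState n × Assign (Var n)) (τ τ' : Seq n) :
    run ψ p (τ ++ τ') = run ψ (run ψ p τ) τ' :=
  List.foldl_append

theorem run_concat (ψ : Property n) (p : DState n × Assign (Var n)) (τ : Seq n)
    (β : Assign (Var n)) :
    run ψ p (τ ++ [β]) = (dfaStep ψ (run ψ p τ).1 (run ψ p τ).2 β, β) :=
  run_append ψ p τ [β]

theorem run_mem_states {ψ : Property n} {p : DState n × Assign (Var n)}
    (hp : p.1 ∈ (dfa ψ).states) (τ : Seq n) : (run ψ p τ).1 ∈ (dfa ψ).states := by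
  induction τ using List.reverseRecOn with
  | nil => exact hp
  | append_singleton τ β _ =>
    rw [run_concat]
    exact dfaStep_mem_states _ _ _ _

/-- All quoted properties in the state reached after `i` steps have, at instant `i`, the truth value
of the given property at instant `0`. -/
theorem run_take_invariant {ψ : Property n} {τ : Seq n} {α₀ : Assign (Var n)}
    {ρ : ℕ → Assign (BVar n)}
    (hρ : ∀ i, i < τ.length →
      ρ i = pairAssign (run ψ ((dfa ψ).start, α₀) (τ.take i)).2 (τ.getD i fun _ _ => 0))
    {i : ℕ} (hi : i < τ.length) :
    (∀ b, .quot b ∈ (run ψ ((dfa ψ).start, α₀) (τ.take i)).1 →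
      (BSat τ.length ρ b i ↔ BSat τ.length ρ (back true ψ) 0)) ∧
    ∃ b, .quot b ∈ (run ψ ((dfa ψ).start, α₀) (τ.take i)).1 := by
  induction i with
  | zero =>
    refine ⟨fun b hb => ?_, back true ψ, rfl⟩
    cases hb
    exact Iff.rfl
  | succ i ih =>
    have hP : (run ψ ((dfa ψ).start, α₀) (τ.take i)).1 ∈ (dfa ψ).states :=
      run_mem_states (start_mem_states ψ) _
    obtain ⟨hinv, a₀, ha₀⟩ := ih (by omega)
    have hρi := hρ i (by omega)
    have hrun : (run ψ ((dfa ψ).start, α₀) (τ.take (i + 1))).1 =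
        dfaStep ψ (run ψ ((dfa ψ).start, α₀) (τ.take i)).1
          (run ψ ((dfa ψ).start, α₀) (τ.take i)).2 (τ.getD i fun _ _ => 0) := by
      rw [List.take_succ_eq_append_getElem (by omega), run_concat,
        List.getD_eq_getElem _ _ (by omega : i < τ.length)]
    rw [hrun]
    constructor
    · intro b hb
      obtain ⟨a, x, ha, hd, hl, hx⟩ := (quot_mem_dfaStep_iff hP).1 hb
      rw [← hρi] at hx
      exact (bsat_iff_of_mem_delta hi hd hx hl).symm.trans (hinv a ha)
    · obtain ⟨b, x, hd, hx, hl⟩ := exists_mem_delta (ρ i) false a₀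
      rw [hρi] at hx
      exact ⟨b, (quot_mem_dfaStep_iff hP).2 ⟨a₀, x, ha₀, hd, hl, hx⟩⟩

/-- The automaton accepts exactly the traces that satisfy the property. -/
theorem run_mem_final_iff {ψ : Property n} (hψ : ψ.LookaheadLE 1) {τ : Seq n} (hτ : τ ≠ [])
    (α₀ : Assign (Var n)) :
    (run ψ ((dfa ψ).start, α₀) τ).1 ∈ (dfa ψ).final ↔ Sat τ ψ := by
  obtain ⟨N, hN⟩ : ∃ N, τ.length = N + 1 :=
    Nat.exists_eq_succ_of_ne_zero (List.length_pos_iff.2 hτ).ne'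
  set ρ : ℕ → Assign (BVar n) := fun i =>
    pairAssign (match i with
      | 0 => α₀
      | j + 1 => τ.getD j fun _ _ => 0) (τ.getD i fun _ _ => 0) with hρdef
  have hρ : ∀ i, i < τ.length →
      ρ i = pairAssign (run ψ ((dfa ψ).start, α₀) (τ.take i)).2 (τ.getD i fun _ _ => 0) := by
    intro i hi
    cases i with
    | zero => rfl
    | succ i =>
      simp only [hρdef]
      rw [List.take_succ_eq_append_getElem (by omega), run_concat,
        List.getD_eq_getElem _ _ (by omega : i < τ.length)]
  have hsat : BSat τ.length ρ (back true ψ) 0 ↔ Sat τ ψ :=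
    (bsat_back_iff (fun i s v => rfl) (fun i s v => rfl) hψ (by omega)).1
  obtain ⟨hinv, a₀, ha₀⟩ := run_take_invariant hρ (show N < τ.length by omega)
  have hP : (run ψ ((dfa ψ).start, α₀) (τ.take N)).1 ∈ (dfa ψ).states :=
    run_mem_states (start_mem_states ψ) _
  have hρN := hρ N (by omega)
  have hrun : (run ψ ((dfa ψ).start, α₀) τ).1 =
      dfaStep ψ (run ψ ((dfa ψ).start, α₀) (τ.take N)).1
        (run ψ ((dfa ψ).start, α₀) (τ.take N)).2 (τ.getD N fun _ _ => 0) := by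
    conv_lhs => rw [← List.take_length (l := τ), hN,
      List.take_succ_eq_append_getElem (by omega), run_concat]
    rw [List.getD_eq_getElem _ _ (by omega : N < τ.length)]
  rw [← hsat, hrun]
  rw [hN] at hinv ⊢
  have hend : ∀ {a b : BProp n} {x : LSym n}, .quot a ∈
      (run ψ ((dfa ψ).start, α₀) (τ.take N)).1 → (b, x) ∈ delta a → x.HoldsAt (ρ N) → b.AtEnd →
      BSat (N + 1) ρ (back true ψ) 0 := fun {a b x} ha hd hx hb =>
    (hinv a ha).1 (bsat_of_atEnd (back true ψ).isUnfoldingClosed_closure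
      (fun c hc => BProp.NoConst.not_atEnd (a := c)
        ((noConst_back true ψ).of_mem_closure hc : BProp.NoConst (.snext c)))
      hd ((hP _ ha).over rfl) hx hb)
  constructor
  · rintro ⟨_, h | h⟩
    · obtain ⟨a, x, ha, hd, _, hx⟩ := (quot_mem_dfaStep_iff hP).1 h
      exact hend ha hd (hρN ▸ hx) trivial
    · obtain ⟨a, x, ha, hd, _, hx⟩ := (qplus_mem_dfaStep_iff hP).1 h
      exact hend ha hd (hρN ▸ hx) trivial
  · intro h
    refine ⟨dfaStep_mem_states _ _ _ _, ?_⟩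
    obtain ⟨b, x, hd, hx, hl⟩ := exists_mem_delta (ρ N) true a₀
    have hl : x.notLast = false := hl
    have hb : b = .tt := by
      have hbE := atEnd_of_mem_delta hd hx hl ((hinv a₀ ha₀).2 h)
      rcases isConst_of_mem_delta hd hl with rfl | rfl
      · rfl
      · exact hbE.elim
    subst hb
    rw [hρN] at hx
    cases hlast : x.last
    · exact .inl ((quot_mem_dfaStep_iff hP).2 ⟨a₀, x, ha₀, hd, hlast, hx⟩)
    · exact .inr ((qplus_mem_dfaStep_iff hP).2 ⟨a₀, x, ha₀, hd, hlast, hx⟩)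

/-! ### History constraints -/

/-- The word can be read along the sequence of assignments that starts with `α` and continues with
`τ`, and `β` is the last assignment of this sequence. -/
inductive Chain (α : Assign (Var n)) : List (Sym n) → Seq n → Assign (Var n) → Prop
  | nil : Chain α [] [] α
  | concat {w : List (Sym n)} {τ : Seq n} {β : Assign (Var n)} {ς : Sym n} {γ : Assign (Var n)} :
      Chain α w τ β → (∀ c ∈ ς, c.Holds (pairAssign β γ)) → Chain α (w ++ [ς]) (τ ++ [γ]) γ

theorem Chain.length_eq {α : Assign (Var n)} {w : List (Sym n)} {τ : Seq n} {β : Assign (Var n)}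
    (h : Chain α w τ β) : w.length = τ.length := by
  induction h with
  | nil => rfl
  | concat _ _ ih => simp [ih]

theorem Automaton.Path.concat {D : Automaton n} {P P' P'' : DState n} {w : List (Sym n)}
    {ς : Sym n} (h : D.Path P w P') (h' : D.trans P' ς P'') : D.Path P (w ++ [ς]) P'' := by
  induction h with
  | nil P => exact .cons h' (.nil _)
  | cons ht _ ih => exact .cons ht (ih h')

theorem Automaton.Path.exists_of_concat {D : Automaton n} {P P'' : DState n} {w : List (Sym n)}
    {ς : Sym n} (h : D.Path P (w ++ [ς]) P'') : ∃ P', D.Path P w P' ∧ D.trans P' ς P'' := by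
  induction w generalizing P with
  | nil =>
    cases h with
    | cons ht hp =>
      cases hp
      exact ⟨P, .nil P, ht⟩
  | cons ς' w ih =>
    cases h with
    | cons ht hp =>
      obtain ⟨P', h₁, h₂⟩ := ih hp
      exact ⟨P', .cons ht h₁, h₂⟩

theorem exists_path_of_run {ψ : Property n} {p : DState n × Assign (Var n)}
    (hp : p.1 ∈ (dfa ψ).states) (τ : Seq n) :
    ∃ w, (dfa ψ).Path p.1 w (run ψ p τ).1 ∧ Chain p.2 w τ (run ψ p τ).2 := by
  induction τ using List.reverseRecOn with
  | nil => exact ⟨[], .nil _, .nil⟩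
  | append_singleton τ β ih =>
    obtain ⟨w, hw, hc⟩ := ih
    obtain ⟨ht, hh⟩ := dfa_trans_and_holds_iff.2
      ⟨run_mem_states hp τ, rfl, (rfl : dfaStep ψ (run ψ p τ).1 (run ψ p τ).2 β = _)⟩
    rw [run_concat]
    exact ⟨_, hw.concat ht, hc.concat hh⟩

theorem run_eq_of_chain {ψ : Property n} {P P' : DState n} {α β : Assign (Var n)}
    {w : List (Sym n)} {τ : Seq n} (hc : Chain α w τ β) (hw : (dfa ψ).Path P w P') :
    run ψ (P, α) τ = (P', β) := by
  induction hc generalizing P' with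
  | nil =>
    cases hw
    rfl
  | concat _ hh ih =>
    obtain ⟨Q, hQ, ht⟩ := hw.exists_of_concat
    rw [run_concat, ih hQ, (dfa_trans_and_holds_iff.1 ⟨ht, hh⟩).2.2]

namespace Formula

theorem holds_rename (e : ℕ ≃ ℕ) (φ : Formula n) (ν : Assign (FVar n)) :
    (φ.rename e).Holds ν ↔ φ.Holds fun s x => ν s (e x.1, x.2) := by
  induction φ generalizing ν with
  | tru => exact Iff.rfl
  | atom c => exact c.holds_map _ ν
  | not a ih => exact not_congr (ih ν)
  | and a b iha ihb => exact and_congr (iha ν) (ihb ν)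
  | or a b iha ihb => exact or_congr (iha ν) (ihb ν)
  | ex s x a ih =>
    refine exists_congr fun d => (ih _).trans (iff_of_eq (congrArg a.Holds ?_))
    funext t y
    by_cases hts : t = s
    · subst hts
      by_cases hyx : y = x
      · subst hyx
        simp
      · have : ((e y.1, y.2) : FVar n t) ≠ (e x.1, x.2) := by
          intro h
          rw [Prod.mk.injEq, e.injective.eq_iff] at h
          exact hyx (Prod.ext h.1 h.2)
        simp [hyx, this]
    · simp [hts]

theorem holds_conj (l : List (Formula n)) (ν : Assign (FVar n)) :
    (conj l).Holds ν ↔ ∀ φ ∈ l, φ.Holds ν := by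
  induction l with
  | nil => simp [conj, Holds]
  | cons a l ih =>
    simp only [List.forall_mem_cons, ← ih]
    exact Iff.rfl

theorem holds_foldr_ex (s : Srt) (k : ℕ) (l : List (Var n s)) (φ : Formula n)
    (ν : Assign (FVar n)) :
    (l.foldr (fun v b => ex s (k, v) b) φ).Holds ν ↔ ∃ ν' : Assign (FVar n), φ.Holds ν' ∧
      ∀ t x, (¬ ∃ v ∈ l, (⟨t, x⟩ : (s : Srt) × FVar n s) = ⟨s, (k, v)⟩) → ν' t x = ν t x := by
  induction l generalizing ν with
  | nil =>
    refine ⟨fun h => ⟨ν, h, fun _ _ _ => rfl⟩, ?_⟩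
    rintro ⟨ν', h, h'⟩
    rwa [show ν' = ν from funext fun t => funext fun x => h' t x (by simp)] at h
  | cons v l ih =>
    simp only [List.foldr_cons, Holds, ih]
    constructor
    · rintro ⟨d, ν', h, h'⟩
      refine ⟨ν', h, fun t x hx => ?_⟩
      simp only [List.exists_mem_cons_iff, not_or] at hx
      rw [h' t x hx.2]
      by_cases hts : t = s
      · subst hts
        have : x ≠ (k, v) := fun h => hx.1 (by rw [h])
        simp [this]
      · simp [hts]
    · rintro ⟨ν', h, h'⟩
      refine ⟨ν' s (k, v), ν', h, fun t x hx => ?_⟩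
      by_cases hx' : (⟨t, x⟩ : (s : Srt) × FVar n s) = ⟨s, (k, v)⟩
      · cases hx'
        simp
      · rw [h' t x (by simpa only [List.exists_mem_cons_iff, not_or] using ⟨hx', hx⟩)]
        by_cases hts : t = s
        · subst hts
          have : x ≠ (k, v) := fun h => hx' (by rw [h])
          simp [this]
        · simp [hts]

/-- The values of the copy `k` of the variables. -/
def copy (ν : Assign (FVar n)) (k : ℕ) : Assign (Var n) := fun s v => ν s (k, v)

theorem holds_exBlock (k : ℕ) (φ : Formula n) (ν : Assign (FVar n)) :
    (exBlock k φ).Holds ν ↔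
      ∃ ν' : Assign (FVar n), φ.Holds ν' ∧ ∀ j, j ≠ k → copy ν' j = copy ν j := by
  simp only [exBlock, holds_foldr_ex]
  constructor
  · rintro ⟨ν₁, ⟨ν₂, h, h₂⟩, h₁⟩
    refine ⟨ν₂, h, fun j hj => funext fun s => funext fun v => ?_⟩
    simp only [copy]
    rw [h₂, h₁] <;>
    · rintro ⟨v', _, h⟩
      cases h
      exact hj rfl
  · rintro ⟨ν', h, h'⟩
    refine ⟨fun s x => match s with
      | .int => ν' .int x
      | .rat => ν .rat x, ⟨ν', h, ?_⟩, ?_⟩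
    · rintro (_ | _) ⟨j, v⟩ hx
      · rfl
      · have hj : j ≠ k := by
          rintro rfl
          exact hx ⟨v, List.mem_finRange v, rfl⟩
        exact congrFun (congrFun (h' j hj) .rat) v
    · rintro (_ | _) ⟨j, v⟩ hx
      · have hj : j ≠ k := by
          rintro rfl
          exact hx ⟨v, List.mem_finRange v, rfl⟩
        exact congrFun (congrFun (h' j hj) .int) v
      · rfl

theorem holds_init (ν : Assign (FVar n)) : (init : Formula n).Holds ν ↔ copy ν 1 = copy ν 0 := by
  simp only [init, Holds, holds_conj, List.forall_mem_map, List.mem_finRange, true_imp_iff,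
    Cstr.Holds, Expr.eval]
  constructor
  · rintro ⟨h, h'⟩
    funext s v
    cases s
    · exact h v
    · exact h' v
  · intro h
    exact ⟨fun v => congrFun (congrFun h .int) v, fun v => congrFun (congrFun h .rat) v⟩

/-- The history constraint of a word relates the first and the last assignment of the sequences
along which the word can be read. -/
theorem holds_history (w : List (Sym n)) (ν : Assign (FVar n)) :
    (history w).Holds ν ↔ ∃ τ, Chain (copy ν 0) w τ (copy ν 1) := by
  induction w using List.reverseRecOn generalizing ν with
  | nil =>
    rw [show (history [] : Formula n) = init from rfl, holds_init]
    constructor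
    · intro h
      rw [h]
      exact ⟨[], .nil⟩
    · rintro ⟨τ, h⟩
      generalize hw : ([] : List (Sym n)) = w at h
      generalize copy ν 0 = α, copy ν 1 = β at h
      cases h with
      | nil => rfl
      | concat => simp at hw
  | append_singleton w ς ih =>
    rw [show history (w ++ [ς]) = (history w).update ς from by simp [history], update,
      holds_exBlock]
    have hstep : ∀ ν' : Assign (FVar n), (and ((history w).rename (_root_.Equiv.swap 1 2))
        (conj (ς.toList.map fun c => atom (c.map fun _ x => (match x.1 with
          | .pre => 2
          | .cur => 1, x.2))))).Holds ν' ↔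
        (∃ τ, Chain (copy ν' 0) w τ (copy ν' 2)) ∧
          ∀ c ∈ ς, c.Holds (pairAssign (copy ν' 2) (copy ν' 1)) := by
      intro ν'
      refine and_congr ?_ ?_
      · rw [holds_rename, ih]
        rfl
      · simp only [holds_conj, List.forall_mem_map, Finset.mem_toList, Holds, Cstr.holds_map]
        refine forall_congr' fun c => forall_congr' fun _ =>
          iff_of_eq (congrArg (Cstr.Holds · c) ?_)
        funext s ⟨t, v⟩
        cases t <;> rfl
    constructor
    · rintro ⟨ν', h, h'⟩
      obtain ⟨⟨τ, hτ⟩, hς⟩ := (hstep ν').1 h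
      rw [h' 1 (by decide)] at hς
      rw [h' 0 (by decide)] at hτ
      exact ⟨_, hτ.concat hς⟩
    · rintro ⟨τ, hτ⟩
      obtain ⟨τ', β, hc, hς⟩ : ∃ τ' β, Chain (copy ν 0) w τ' β ∧
          ∀ c ∈ ς, c.Holds (pairAssign β (copy ν 1)) := by
        generalize hw : w ++ [ς] = w' at hτ
        generalize copy ν 0 = α, copy ν 1 = γ at hτ
        cases hτ with
        | nil => simp at hw
        | concat hc hς =>
          obtain ⟨rfl, h⟩ := List.append_inj' hw rfl
          cases h
          exact ⟨_, _, hc, hς⟩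
      refine ⟨fun s x => if x.1 = 2 then β s x.2 else ν s x, (hstep _).2 ⟨⟨τ', ?_⟩, ?_⟩, ?_⟩
      · exact hc
      · exact hς
      · intro j hj
        funext s v
        simp [copy, hj]

end Formula

/-! ### Short extensions -/

/-- With a finite summary, every state to which a nonempty extension leads from a reachable state is
also reached by a nonempty extension of bounded length: it suffices to consider one word for each
source, target and equivalence class of history constraints. -/
theorem exists_bound {ψ : Property n} (hfin : HasFiniteSummary ψ) :
    ∃ N : ℕ, ∀ (w₀ : List (Sym n)) (P : DState n) (α : Assign (Var n)) (τ : Seq n),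
      (dfa ψ).Path (dfa ψ).start w₀ P → τ ≠ [] →
      ∃ τ' : Seq n, τ' ≠ [] ∧ τ'.length ≤ N ∧ (run ψ (P, α) τ').1 = (run ψ (P, α) τ).1 := by
  obtain ⟨Φ, sim, hsum, hclasses⟩ := hfin
  have hcov := hsum.historySet.1
  -- triples of source, target and class, with a nonempty word that realizes them
  let real : DState n × DState n × Set (Formula n) → List (Sym n) → Prop := fun z w =>
    w ≠ [] ∧ (dfa ψ).Path z.1 w z.2.1 ∧ ∃ φ, (z.2.1, φ) ∈ Φ ∧ (Formula.history w).Equiv φ ∧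
      z.2.2 = {χ ∈ Prod.snd '' Φ | sim φ χ}
  let Z := {z | (∃ w, real z w) ∧ z.1 ∈ (dfa ψ).states}
  have hZ : Z.Finite := by
    refine ((finite_states ψ).prod ((finite_states ψ).prod hclasses)).subset ?_
    rintro ⟨P, P', K⟩ ⟨⟨w, _, _, φ, hφ, _, rfl⟩, hP⟩
    exact ⟨hP, (hcov.1 _ hφ).1, φ, ⟨_, hφ, rfl⟩, rfl⟩
  have hrep : ∀ z ∈ Z, ∃ w, real z w := fun z hz => hz.1
  choose! rep hrep using hrep
  obtain ⟨N, hN⟩ := (hZ.image fun z => (rep z).length).bddAbove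
  refine ⟨N, fun w₀ P α τ hP hτ => ?_⟩
  have hPs : P ∈ (dfa ψ).states := by
    obtain ⟨φ, hφ, _⟩ := hcov.2 w₀ P [] P hP (.nil P)
    exact (hcov.1 _ hφ).1
  obtain ⟨w, hw, hc⟩ := exists_path_of_run (p := (P, α)) hPs τ
  set P' := (run ψ (P, α) τ).1 with hP'
  obtain ⟨φ, hφ, hequiv⟩ := hcov.2 w₀ P w P' hP hw
  have hwne : w ≠ [] := by
    rintro rfl
    exact hτ (List.length_eq_zero_iff.1 hc.length_eq.symm)
  have hz : (P, P', {χ ∈ Prod.snd '' Φ | sim φ χ}) ∈ Z :=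
    ⟨⟨w, hwne, hw, φ, hφ, hequiv, rfl⟩, hPs⟩
  obtain ⟨hne, hpath, χ, hχ, hequiv', hK⟩ := hrep _ hz
  have hlen : (rep (P, P', {χ ∈ Prod.snd '' Φ | sim φ χ})).length ≤ N := hN ⟨_, hz, rfl⟩
  generalize rep (P, P', {χ ∈ Prod.snd '' Φ | sim φ χ}) = w' at hne hpath hequiv' hlen
  have hsim : sim φ χ := by
    have : χ ∈ {χ' ∈ Prod.snd '' Φ | sim χ χ'} := ⟨⟨_, hχ, rfl⟩, hsum.equivalence.refl χ⟩
    rw [← hK] at this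
    exact this.2
  -- the assignment to `V₀ ∪ V` given by the first and the last assignment of the extension
  let ν : Assign (FVar n) := fun s x => if x.1 = 0 then α s x.2 else (run ψ (P, α) τ).2 s x.2
  have hν : (Formula.history w).Holds ν := (Formula.holds_history w ν).2 ⟨τ, hc⟩
  obtain ⟨ν', hν', h0⟩ := hsum.initial P' φ χ hφ hχ hsim ν ((hequiv ν).1 hν)
  obtain ⟨τ', hτ'⟩ := (Formula.holds_history w' ν').1 ((hequiv' ν').2 hν')
  have h0' : Formula.copy ν' 0 = α := funext fun s => funext fun v => (h0 s v).symm
  rw [h0'] at hτ'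
  refine ⟨τ', ?_, hτ'.length_eq ▸ hlen, ?_⟩
  · rintro rfl
    exact hne (List.length_eq_zero_iff.1 hτ'.length_eq)
  · rw [run_eq_of_chain hτ' hpath]

/-! ### Computing the monitoring state -/

/-- The values of the variables at one of the two instants. -/
def atTime (ν : Assign (BVar n)) (t : Time) : Assign (Var n) := fun s v => ν s (t, v)

theorem pairAssign_atTime (ν : Assign (BVar n)) :
    pairAssign (atTime ν .pre) (atTime ν .cur) = ν := by
  funext s ⟨t, v⟩
  cases t <;> rfl

theorem qfDef_dfaStep (ψ : Property n) (P P' : DState n) :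
    QFDef fun ν : Assign (BVar n) => dfaStep ψ P (atTime ν .pre) (atTime ν .cur) = P' := by
  set C := dfaCstrs ψ P
  set D := C ∪ C.image Cstr.neg with hD
  -- the successor depends only on the set of those constraints over `C` that hold
  refine (QFDef.exists_mem (Finset.finite_toSet (D.powerset.filter fun ς =>
      {q' | ∃ q ∈ P, ∃ x : Sym n, NTrans (back true ψ) q x q' ∧ x ⊆ ς} = P'))
    (S := fun ς ν => ∀ c ∈ (D : Set (Cstr (BVar n))), (c ∈ ς ↔ c.Holds ν)) fun ς _ =>
      QFDef.forall_mem (Finset.finite_toSet D) fun c _ => ?_).congr fun ν => ?_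
  · by_cases hc : c ∈ ς
    · exact c.qfDef_holds.congr fun ν => by simp [hc]
    · exact c.qfDef_holds.not.congr fun ν => by simp [hc]
  · rw [dfaStep, pairAssign_atTime]
    constructor
    · intro h
      refine ⟨satSym C ν, ?_, fun c hc => ?_⟩
      · simp only [Finset.coe_filter, Finset.mem_powerset]
        exact ⟨Finset.filter_subset _ _, h⟩
      · rw [mem_satSym]
        exact and_iff_right hc
    · rintro ⟨ς, hς, h⟩
      simp only [Finset.coe_filter, Finset.mem_powerset] at hς
      have : satSym C ν = ς := by
        ext c
        rw [mem_satSym]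
        exact ⟨fun hc => (h c hc.1).2 hc.2, fun hc => ⟨hς.1 hc, (h c (hς.1 hc)).1 hc⟩⟩
      rw [this]
      exact hς.2

/-- Some extension of length `l` leads from the state `P` and the assignment `α` to a state
in `F`. -/
def CanReach (ψ : Property n) (F : Set (DState n)) (l : ℕ) (P : DState n)
    (α : Assign (Var n)) : Prop :=
  ∃ τ : Seq n, τ.length = l ∧ (run ψ (P, α) τ).1 ∈ F

theorem canReach_succ_iff {ψ : Property n} {F : Set (DState n)} {l : ℕ} {P : DState n}
    {α : Assign (Var n)} :
    CanReach ψ F (l + 1) P α ↔ ∃ β, CanReach ψ F l (dfaStep ψ P α β) β := by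
  constructor
  · rintro ⟨_ | ⟨β, τ⟩, hl, h⟩
    · simp at hl
    · exact ⟨β, τ, by simpa using hl, h⟩
  · rintro ⟨β, τ, hl, h⟩
    exact ⟨β :: τ, by simp [hl], h⟩

theorem qfDef_canReach (ψ : Property n) (F : Set (DState n)) (l : ℕ) (P : DState n) :
    QFDef (CanReach ψ F l P) := by
  induction l generalizing P with
  | zero =>
    refine (QFDef.const (P ∈ F)).congr fun α => ?_
    simp only [CanReach, List.length_eq_zero_iff, exists_eq_left]
    exact Iff.rfl
  | succ l ih =>
    have hT : QFDef fun ν : Assign (BVar n) => ∃ P' ∈ (dfa ψ).states,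
        dfaStep ψ P (atTime ν .pre) (atTime ν .cur) = P' ∧ CanReach ψ F l P' (atTime ν .cur) :=
      QFDef.exists_mem (finite_states ψ) fun P' _ => (qfDef_dfaStep ψ P P').and
        ((ih P').comp (σ := fun ν : Assign (BVar n) => atTime ν .cur)
          fun s v => IsTerm.var (X := BVar n) s (Time.cur, v))
    have hSrt : Finite Srt := Finite.of_surjective (fun b : Bool => if b then Srt.int else Srt.rat)
      fun s => by cases s; exacts [⟨true, rfl⟩, ⟨false, rfl⟩]
    have hTime : Finite Time := Finite.of_surjective
      (fun b : Bool => if b then Time.pre else Time.cur)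
      fun s => by cases s; exacts [⟨true, rfl⟩, ⟨false, rfl⟩]
    refine ((hT.exists_block {z | z.2.1 = .cur} (Set.toFinite _)).comp
      (σ := fun α => pairAssign α α) ?_).congr fun α => ?_
    · rintro s ⟨t, v⟩
      cases t <;> exact .var s v
    · rw [canReach_succ_iff]
      constructor
      · rintro ⟨β, h⟩
        refine ⟨pairAssign α β, ⟨_, dfaStep_mem_states ψ P α β, rfl, h⟩, ?_⟩
        rintro s ⟨t, v⟩ hx
        cases t
        · rfl
        · exact absurd rfl hx
      · rintro ⟨ν, ⟨_, _, rfl, h⟩, hν⟩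
        have : atTime ν .pre = α := funext fun s => funext fun v =>
          hν s (.pre, v) (fun h : Time.pre = Time.cur => Time.noConfusion h)
        rw [this] at h
        exact ⟨_, h⟩

/-- A primitive recursive predicate may be chosen for each element of a finite type. -/
theorem PrimrecPred.of_forall_finite {ι γ : Type*} [Primcodable ι] [Finite ι] [Primcodable γ]
    {δ : Type*} [Primcodable δ] {f : γ → ι} {g : γ → δ} (hf : Primrec f) (hg : Primrec g)
    {S : ι → δ → Prop} (hS : ∀ i, PrimrecPred (S i)) : PrimrecPred fun c => S (f c) (g c) :=
  (PrimrecPred.exists_mem (S := fun i c => f c = i ∧ S i (g c)) (Set.finite_univ (α := ι))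
    fun i _ => (Primrec.eq.comp hf (Primrec.const i)).and ((hS i).comp hg)).of_eq
    fun c => by simp

theorem monitoringSolvable_of_bound {ψ : Property n} (hψ : ψ.LookaheadLE 1) {N : ℕ}
    (hN : ∀ (w₀ : List (Sym n)) (P : DState n) (α : Assign (Var n)) (τ : Seq n),
      (dfa ψ).Path (dfa ψ).start w₀ P → τ ≠ [] →
      ∃ τ' : Seq n, τ' ≠ [] ∧ τ'.length ≤ N ∧ (run ψ (P, α) τ').1 = (run ψ (P, α) τ).1) :
    MonitoringSolvable ψ := by
  have : Finite (dfa ψ).states := finite_states ψ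
  obtain ⟨M, ⟨e⟩⟩ := Finite.exists_equiv_fin (dfa ψ).states
  let E := (Fin (n .int) → ℤ) × (Fin (n .rat) → ℤ × ℕ)
  let step : Fin M × E → E → Fin M × E := fun p b =>
    (e ⟨dfaStep ψ (e.symm p.1).1 (decodeAssign p.2) (decodeAssign b),
      dfaStep_mem_states _ _ _ _⟩, b)
  have hstep : Primrec₂ step := by
    refine Primrec.pair (Primrec.of_fibers fun v => ?_) Primrec.snd
    refine (PrimrecPred.of_forall_finite
      (S := fun i (c : E × E) => dfaStep ψ (e.symm i).1 (decodeAssign c.1) (decodeAssign c.2) =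
        (e.symm v).1) (Primrec.fst.comp Primrec.fst)
      ((Primrec.snd.comp Primrec.fst).pair Primrec.snd) fun i => ?_).of_eq fun c => ?_
    · refine (qfDef_dfaStep ψ (e.symm i).1 (e.symm v).1).primrecPred
        (dec := fun c : E × E => pairAssign (decodeAssign c.1) (decodeAssign c.2)) ?_
      rintro s ⟨t, x⟩
      cases t
      · exact primrecDom_decodeAssign Primrec.fst s x
      · exact primrecDom_decodeAssign Primrec.snd s x
    · rw [← e.eq_symm_apply, Subtype.ext_iff]
  -- the monitoring state as a function of the state and the last assignment
  let ext : Set (DState n) → Fin M × E → Prop := fun F p =>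
    ∃ l ∈ Set.Icc 1 N, CanReach ψ F l (e.symm p.1).1 (decodeAssign p.2)
  have hext : ∀ F, PrimrecPred (ext F) := fun F =>
    PrimrecPred.of_forall_finite (S := fun i (a : E) =>
      ∃ l ∈ Set.Icc 1 N, CanReach ψ F l (e.symm i).1 (decodeAssign a)) Primrec.fst Primrec.snd
      fun i => PrimrecPred.exists_mem (Set.finite_Icc 1 N) fun l _ =>
        (qfDef_canReach ψ F l _).primrecPred (dec := decodeAssign)
          fun s x => primrecDom_decodeAssign Primrec.id s x
  have hfinal : PrimrecPred fun p : Fin M × E => (e.symm p.1).1 ∈ (dfa ψ).final :=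
    PrimrecPred.of_forall_finite (S := fun i (_ : E) => (e.symm i).1 ∈ (dfa ψ).final)
      Primrec.fst Primrec.snd fun i =>
        ⟨fun _ => Classical.propDecidable _,
          Primrec.const (@decide ((e.symm i).1 ∈ (dfa ψ).final) (Classical.propDecidable _))⟩
  let out : Fin M × E → RV := fun p =>
    if (e.symm p.1).1 ∈ (dfa ψ).final then
      if ext (dfa ψ).finalᶜ p then .cs else .ps
    else
      if ext (dfa ψ).final p then .cv else .pv
  have hout : Primrec out :=
    Primrec.ite hfinal (Primrec.ite (hext _) (Primrec.const _) (Primrec.const _))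
      (Primrec.ite (hext _) (Primrec.const _) (Primrec.const _))
  let p₀ : Fin M × E := (e ⟨_, start_mem_states ψ⟩, (fun _ => 0, fun _ => (0, 0)))
  have hfoldl : Primrec fun t : SeqCode n => t.foldl step p₀ :=
    Primrec.list_foldl (h := fun _ q => step q.1 q.2) Primrec.id (Primrec.const p₀)
      (hstep.comp (Primrec.fst.comp Primrec.snd) (Primrec.snd.comp Primrec.snd)).to₂
  refine ⟨fun t => out (t.foldl step p₀), (hout.comp hfoldl).to_comp, fun t ht => ?_⟩
  have hfold : ∀ (t : SeqCode n) (p : Fin M × E),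
      ((e.symm (t.foldl step p).1).1, decodeAssign (t.foldl step p).2) =
        run ψ ((e.symm p.1).1, decodeAssign p.2) (decodeSeq t) := by
    intro t
    induction t with
    | nil => exact fun p => rfl
    | cons a t ih =>
      intro p
      rw [List.foldl_cons, ih]
      simp only [step, Equiv.symm_apply_apply]
      rfl
  obtain ⟨p, hp⟩ : ∃ p, p = t.foldl step p₀ := ⟨_, rfl⟩
  set α₀ : Assign (Var n) := decodeAssign p₀.2
  have hrun : ((e.symm p.1).1, decodeAssign p.2) =
      run ψ ((dfa ψ).start, α₀) (decodeSeq t) := by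
    rw [hp, hfold, show (e.symm p₀.1).1 = (dfa ψ).start by simp [p₀]]
  have hne : decodeSeq t ≠ [] := by simpa [decodeSeq] using ht
  have hsat : ∀ τ' : Seq n, (run ψ ((e.symm p.1).1, decodeAssign p.2) τ').1 ∈ (dfa ψ).final ↔
      Sat (decodeSeq t ++ τ') ψ := fun τ' => by
    rw [hrun, ← run_append]
    exact run_mem_final_iff hψ (by simp [hne]) α₀
  have hsat₀ : (e.symm p.1).1 ∈ (dfa ψ).final ↔ Sat (decodeSeq t) ψ := by
    have := hsat []
    rwa [List.append_nil] at this
  have hext_iff : ∀ F, ext F p ↔ ∃ τ' : Seq n, τ' ≠ [] ∧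
      (run ψ ((e.symm p.1).1, decodeAssign p.2) τ').1 ∈ F := by
    intro F
    constructor
    · rintro ⟨l, hl, τ', rfl, h⟩
      exact ⟨τ', List.length_pos_iff.1 hl.1, h⟩
    · rintro ⟨τ, hτ, h⟩
      obtain ⟨w₀, hw₀, _⟩ := exists_path_of_run (p := ((dfa ψ).start, α₀))
        (start_mem_states ψ) (decodeSeq t)
      rw [← hrun] at hw₀
      obtain ⟨τ', hτ', hle, heq⟩ := hN w₀ _ (decodeAssign p.2) τ hw₀ hτ
      exact ⟨τ'.length, ⟨List.length_pos_iff.2 hτ', hle⟩, τ', rfl, heq ▸ h⟩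
  beta_reduce
  rw [← hp]
  simp only [out]
  split_ifs with h₁ h₂ h₂
  · obtain ⟨τ', hτ', h⟩ := (hext_iff _).1 h₂
    exact ⟨hsat₀.1 h₁, τ', hτ', fun hs => h ((hsat τ').2 hs)⟩
  · refine ⟨hsat₀.1 h₁, fun τ' hτ' => ?_⟩
    by_contra hs
    exact h₂ ((hext_iff _).2 ⟨τ', hτ', fun h => hs ((hsat τ').1 h)⟩)
  · obtain ⟨τ', hτ', h⟩ := (hext_iff _).1 h₂
    exact ⟨fun hs => h₁ (hsat₀.2 hs), τ', hτ', (hsat τ').1 h⟩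
  · exact ⟨fun hs => h₁ (hsat₀.2 hs), fun τ' hτ' hs =>
      h₂ ((hext_iff _).2 ⟨τ', hτ', (hsat τ').2 hs⟩)⟩

end

end ALTLf

theorem mainTheorem2 (n : ALTLf.Srt → ℕ) (ψ : ALTLf.Property n) (hlook : ψ.LookaheadLE 1)
    (hfin : ALTLf.HasFiniteSummary ψ) : ALTLf.MonitoringSolvable ψ := by
  obtain ⟨N, hN⟩ := ALTLf.exists_bound hfin
  exact ALTLf.monitoringSolvable_of_bound hlook hN
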